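/- A \emph{tropical (plane) curve} is a nonempty finite graph $\Gamma$ embedded in $\mathbb{R}^2$ with straight edges of rational slope, some of which may be unbounded rays (edges meet only at vertices, every vertex has an edge), such that at each vertex $v$ the primitive integer direction vectors $u_e$ of the edges $e$ emanating from $v$ satisfy $\sum_{e\ni v}u_e=0$. The dual polygon $P_v$ of a vertex $v$ is the convex lattice polygon having, for each edge $e$ at $v$, one edge of lattice length $1$ with outer normal $u_e$, and no other edges. Placing the $P_v$ so that the polygons of the two ends of each bounded edge are glued along the edge dual to it, one obtains the \emph{subdivided dual polygon} $\{P_v\}$ and the \emph{dual polygon} $P_\Gamma=\bigcup_v P_v$, both considered up to lattice translation. The curve is \emph{smooth} if each vertex is trivalent and each $P_v$ is a triangle of area $\frac12$. Its \emph{genus} is its first Betti number. If two tropical curves meet only in relative interiors of non-parallel edges, their intersection divisor is the sum of the common points $p$ with multiplicity $|\det(u,u')|$, where $u,u'$ are the primitive directions of the two edges through $p$. The \emph{stable intersection} $\Gamma\cdot\Gamma'$ is the limit, as $\epsilon\to0^+$, of the intersection divisors of $\Gamma$ and $\Gamma'+\epsilon c$, where $c\in\mathbb{R}^2$ is a vector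 such that $\Gamma$ and $\Gamma'+\epsilon c$ meet in this way for all small $\epsilon>0$. Let $\mathcal{R}_\Gamma^{st}$ be the set of divisors $\Gamma\cdot\Gamma'$, where $\Gamma'$ is any tropical curve whose dual polygon coincides with that of $\Gamma$. \textbf{Proposition.} Let $\Gamma$ be a smooth tropical plane curve of genus $g$ with $d$ vertices. Then $\mathcal{R}_\Gamma^{st}$ contains a $(d-g)$-dimensional set of divisors: there is an affine subspace $L\subseteq(\mathbb{R}^2)^d$ of dimension $d-g$ and a nonempty relatively open subset $W\subseteq L$ such that $W\subseteq\Gamma^d$ and $x_1+\dots+x_d\in\mathcal{R}_\Gamma^{st}$ for all $(x_1,\dots,x_d)\in W$. In fact, $W$ can be chosen so that each of these divisors is $\Gamma\cdot\Gamma'$ for a smooth tropical curve $\Gamma'$ with the same subdivided dual polygon as $\Gamma$. -/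

import Mathlib

open Filter Topology

noncomputable section

/-- The real plane. Only its linear and topological structure is used. -/
abbrev Plane := ℝ × ℝ

/-- A lattice vector, seen in the plane. -/
def latticeVec (u : ℤ × ℤ) : Plane := ((u.1 : ℝ), (u.2 : ℝ))

def latticeDet (u u' : ℤ × ℤ) : ℤ := u.1 * u'.2 - u.2 * u'.1

/-- Rotation by a right angle, `u ↦ (-u₂, u₁)`. -/
def latticeRot (u : ℤ × ℤ) : ℤ × ℤ := (-u.2, u.1)

/-- The face of `P` on which the linear functional `⟨·, u⟩` is maximal. -/
def planeFace (P : Set Plane) (u : ℤ × ℤ) : Set Plane :=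
  {x | x ∈ P ∧ ∀ y ∈ P, y.1 * u.1 + y.2 * u.2 ≤ x.1 * u.1 + x.2 * u.2}

/-- Combinatorial data of a finite graph drawn in the plane with straight edges, some of which may
be unbounded: positions of the vertices, the bounded edges, and for each vertex the set of
direction vectors of all edges (bounded or not) emanating from it. -/
structure PlaneGraph where
  n : ℕ
  pos : Fin n → Plane
  graph : SimpleGraph (Fin n)
  star : Fin n → Finset (ℤ × ℤ)

namespace PlaneGraph

/-- The bounded edge from `v` to `w` emanates from `v` in direction `u`. -/
def HeadsTo (Γ : PlaneGraph) (v : Fin Γ.n) (u : ℤ × ℤ) (w : Fin Γ.n) : Prop :=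
  u ∈ Γ.star v ∧ Γ.graph.Adj v w ∧ ∃ t : ℝ, 0 < t ∧ Γ.pos w = Γ.pos v + t • latticeVec u

/-- The edge emanating from `v` in direction `u` is an unbounded ray. -/
def IsRay (Γ : PlaneGraph) (v : Fin Γ.n) (u : ℤ × ℤ) : Prop :=
  u ∈ Γ.star v ∧ ∀ w, ¬ Γ.HeadsTo v u w

/-- `e` is the relative interior of an edge (bounded or unbounded) with direction vector `u`.
A bounded edge is listed with both directions `u` and `-u`. -/
def IsOpenEdge (Γ : PlaneGraph) (e : Set Plane) (u : ℤ × ℤ) : Prop :=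
  (∃ v w, Γ.HeadsTo v u w ∧ e = openSegment ℝ (Γ.pos v) (Γ.pos w)) ∨
  (∃ v, Γ.IsRay v u ∧ e = {x | ∃ t : ℝ, 0 < t ∧ x = Γ.pos v + t • latticeVec u})

/-- The underlying subset of the plane. -/
def support (Γ : PlaneGraph) : Set Plane :=
  {x | (∃ v, x = Γ.pos v) ∨ ∃ e u, Γ.IsOpenEdge e u ∧ x ∈ e}

/-- A (not necessarily smooth) tropical plane curve: a nonempty finite graph embedded in the plane
with straight edges of rational slope, some of which may be unbounded, such that the primitive
direction vectors of the edges at each vertex sum to zero. -/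
structure IsTropicalCurve (Γ : PlaneGraph) : Prop where
  nonempty : 0 < Γ.n
  pos_injective : Function.Injective Γ.pos
  star_nonempty : ∀ v, (Γ.star v).Nonempty
  primitive : ∀ v, ∀ u ∈ Γ.star v, IsCoprime u.1 u.2
  adj_heads : ∀ v w, Γ.graph.Adj v w → ∃ u, Γ.HeadsTo v u w
  /-- no vertex lies in the relative interior of an edge -/
  vertex_notMem : ∀ e u, Γ.IsOpenEdge e u → ∀ v, Γ.pos v ∉ e
  /-- distinct edges have disjoint relative interiors -/
  edge_disjoint : ∀ e u e' u', Γ.IsOpenEdge e u → Γ.IsOpenEdge e' u' → (e ∩ e').Nonempty → e = e'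
  balanced : ∀ v, ∑ u ∈ Γ.star v, u = 0

/-- Smoothness: each vertex is trivalent and its dual triangle has area `1/2`. The edge vectors of
that triangle are the rotated direction vectors, so twice its area is the absolute value of the
determinant of any two of them. -/
def IsSmooth (Γ : PlaneGraph) : Prop :=
  ∀ v, (Γ.star v).card = 3 ∧
    ∀ u ∈ Γ.star v, ∀ u' ∈ Γ.star v, u ≠ u' → |latticeDet u u'| = 1

/-- The genus: the first Betti number `#edges - #vertices + #components` of the graph of bounded
edges (unbounded rays contribute nothing to homology). -/
def genus (Γ : PlaneGraph) : ℤ :=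
  (Nat.card Γ.graph.edgeSet : ℤ) - Γ.n + Nat.card Γ.graph.ConnectedComponent

def translate (Γ : PlaneGraph) (c : Plane) : PlaneGraph where
  n := Γ.n
  pos := fun v => Γ.pos v + c
  graph := Γ.graph
  star := Γ.star

/-- `P` is a dual polygon of the vertex `v`: a convex lattice polygon whose edges are exactly, for
each edge of `Γ` at `v` with primitive direction `u`, one edge of lattice length one with outer
normal `u`. It is determined up to lattice translation. (A two-valent vertex has a segment.) -/
def IsDualCell (Γ : PlaneGraph) (v : Fin Γ.n) (P : Set Plane) : Prop :=
  P = convexHull ℝ (⋃ u ∈ Γ.star v, planeFace P u) ∧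
  (∀ u ∈ Γ.star v, ∃ m : ℤ × ℤ,
    planeFace P u = segment ℝ (latticeVec m) (latticeVec (m + latticeRot u))) ∧
  (∀ c : ℤ × ℤ, IsCoprime c.1 c.2 → c ∉ Γ.star v → (planeFace P c).Subsingleton)

/-- Dual cells of all the vertices, placed so that the cells of the two ends of a bounded edge are
glued along the edge dual to it. -/
def IsDualPlacement (Γ : PlaneGraph) (P : Fin Γ.n → Set Plane) : Prop :=
  (∀ v, Γ.IsDualCell v (P v)) ∧
  (∀ v u w, Γ.HeadsTo v u w → planeFace (P v) u = planeFace (P w) (-u))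

/-- The subdivided dual polygons `{P_v}` of `Γ`. The subdivided dual polygon is defined only up to
lattice translation; this is the collection of its representatives. -/
def dualSubdivisions (Γ : PlaneGraph) : Set (Set (Set Plane)) :=
  {S | ∃ P, Γ.IsDualPlacement P ∧ S = Set.range P}

/-- The dual polygons `⋃ P_v` of `Γ`: the lattice translates of a single polygon. -/
def dualPolygons (Γ : PlaneGraph) : Set (Set Plane) :=
  {Q | ∃ S ∈ Γ.dualSubdivisions, Q = ⋃₀ S}

/-- The dual polygons coincide (as polygons up to lattice translation). -/
def SameDualPolygon (Γ Γ' : PlaneGraph) : Prop :=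
  Γ.dualPolygons = Γ'.dualPolygons

/-- The subdivided dual polygons coincide (up to lattice translation). -/
def SameSubdividedDualPolygon (Γ Γ' : PlaneGraph) : Prop :=
  Γ.dualSubdivisions = Γ'.dualSubdivisions

end PlaneGraph

/-- The divisor `x₁ + ⋯ + x_k` of a tuple of points. -/
def divisorOf {k : ℕ} (x : Fin k → Plane) : Plane →₀ ℤ :=
  ∑ i, Finsupp.single (x i) 1

namespace PlaneGraph

/-- `Γ` and `Γ'` intersect properly, with intersection divisor `D`: each common point lies in the
relative interior of an edge of `Γ` and of an edge of `Γ'`, these edges are not parallel, and the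
point has multiplicity `|det(u, u')|` in `D`. -/
def IsProperIntersection (Γ Γ' : PlaneGraph) (D : Plane →₀ ℤ) : Prop :=
  (∀ p, p ∉ Γ.support ∩ Γ'.support → D p = 0) ∧
  (∀ p ∈ Γ.support ∩ Γ'.support, ∃ e u e' u', Γ.IsOpenEdge e u ∧ p ∈ e ∧
    Γ'.IsOpenEdge e' u' ∧ p ∈ e' ∧ latticeDet u u' ≠ 0 ∧ D p = |latticeDet u u'|)

/-- `D` is the stable intersection `Γ · Γ'`: for some vector `c`, the curves `Γ` and `ε c + Γ'`
intersect properly for all small `ε > 0`, and `D` is the limit of their intersection divisors as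
`ε → 0`. Convergence of effective divisors is convergence of the points, suitably labelled. -/
def IsStableIntersection (Γ Γ' : PlaneGraph) (D : Plane →₀ ℤ) : Prop :=
  ∃ (c : Plane) (k : ℕ) (p : ℝ → Fin k → Plane) (q : Fin k → Plane),
    (∀ᶠ ε in 𝓝[>] (0 : ℝ), Γ.IsProperIntersection (Γ'.translate (ε • c)) (divisorOf (p ε))) ∧
    Tendsto p (𝓝[>] (0 : ℝ)) (𝓝 q) ∧ D = divisorOf q

/-- The set `R_Γ^st` of divisors `Γ · Γ'`, where `Γ'` is any tropical curve with the same dual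
polygon as `Γ`. -/
def stableLocus (Γ : PlaneGraph) : Set (Plane →₀ ℤ) :=
  {D | ∃ Γ' : PlaneGraph, Γ'.IsTropicalCurve ∧ Γ.SameDualPolygon Γ' ∧ Γ.IsStableIntersection Γ' D}

/-- The pullback to `Γ^k` of a set of divisors along `Γ^k → Γ^k / S_k`. -/
def pullback (Γ : PlaneGraph) (k : ℕ) (R : Set (Plane →₀ ℤ)) : Set (Fin k → Plane) :=
  {x | (∀ i, x i ∈ Γ.support) ∧ divisorOf x ∈ R}

end PlaneGraph

end

/-! Let `e` and `k` be the numbers of bounded edges and of components of the graph, so that `d - g =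
2d - e - k`. Fix a vector `c` of irrational slope, parallel to no edge. The three directions at a
vertex sum to zero and have determinants `±1`, so they can be labelled `I, J, K` with `c = aI + bJ`
and `0 < a < b`. Then `c + aK = (b - a)J`: a tripod displaced along `c` meets the original one in a
single point, on its own `K`-ray and the original `J`-ray, with multiplicity one. Hence `Γ` meets a
small translate of itself along `c` in exactly one point near each vertex.

The same is true when the vertices are displaced by small vectors `δ v` in these open sectors, as
long as the bounded edges keep their slopes. The displaced curve is tropical with the same dual
subdivision (`deform_isTropicalCurve`, `deform_sameSubdividedDualPolygon`), it meets `Γ` properly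
(`isProperIntersection_deform`), and the displacement of the intersection points from the vertices
is a linear function `shift` of `δ`.

The slope-preserving displacements form a space of dimension at least `2d - e`
(`le_finrank_slopeSpace`), so it suffices that the kernel of `shift` on it has dimension at most `k`
(`finrank_ker_shift_le`). An element of the kernel moves each vertex `v` along `K v`. A moving
vertex pushes its `I`- and `J`-edges sideways, so their other ends move as well, and these edges are
again `I`- or `J`-edges there. The moving vertices thus form strands that run transversally to `c`,
and the remaining edges start on the side opposite to `c`. A connected component of the graph can
therefore never get past a strand that it contains: it lies below it (`below_of_reachable`). Looking
in direction `c`, a last edge of the union of all strands must then belong to every one of them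
(`exists_mem_substrand`). So each component has a vertex that moves whenever anything in the
component moves, and the value there, a multiple of `K`, determines the kernel element on the
component. -/

noncomputable section

/-! ### Determinants and primitive lattice vectors -/

/-- The determinant of two vectors of the plane. -/
def cross (p q : Plane) : ℝ := p.1 * q.2 - p.2 * q.1

/-- `cross p` as a linear functional. -/
def crossLin (p : Plane) : Plane →ₗ[ℝ] ℝ where
  toFun := cross p
  map_add' x y := by simp [cross]; ring
  map_smul' r x := by simp [cross]; ring

theorem cross_add_right (p q r : Plane) : cross p (q + r) = cross p q + cross p r := by
  simp [cross]; ring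

theorem cross_add_left (p q r : Plane) : cross (p + q) r = cross p r + cross q r := by
  simp [cross]; ring

theorem cross_sub_right (p q r : Plane) : cross p (q - r) = cross p q - cross p r := by
  simp [cross]; ring

theorem cross_smul_right (t : ℝ) (p q : Plane) : cross p (t • q) = t * cross p q := by
  simp [cross]; ring

theorem cross_smul_left (t : ℝ) (p q : Plane) : cross (t • p) q = t * cross p q := by
  simp [cross]; ring

theorem cross_neg_left (p q : Plane) : cross (-p) q = -cross p q := by
  simp [cross]; ring

theorem cross_neg_right (p q : Plane) : cross p (-q) = -cross p q := by
  simp [cross]; ring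

@[simp] theorem cross_same (p : Plane) : cross p p = 0 := by
  simp [cross]; ring

@[simp] theorem cross_zero_right (p : Plane) : cross p 0 = 0 := by simp [cross]

theorem cross_comm (p q : Plane) : cross p q = -cross q p := by
  simp [cross]; ring

@[fun_prop]
theorem continuous_cross (p : Plane) : Continuous (cross p) := by
  unfold cross; fun_prop

/-- Expansion of a vector in the basis `u, c`. -/
theorem eq_cross_smul_sub {c u : Plane} (h : cross c u ≠ 0) (x : Plane) :
    x = (cross c x / cross c u) • u - (cross u x / cross c u) • c := by
  have h' : c.1 * u.2 - c.2 * u.1 ≠ 0 := h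
  ext
  · simp [cross]; field_simp; ring
  · simp [cross]; field_simp; ring

theorem latticeVec_neg (u : ℤ × ℤ) : latticeVec (-u) = -latticeVec u := by
  ext <;> simp [latticeVec]

theorem latticeVec_add (u u' : ℤ × ℤ) : latticeVec (u + u') = latticeVec u + latticeVec u' := by
  ext <;> simp [latticeVec]

theorem cross_latticeVec (u u' : ℤ × ℤ) :
    cross (latticeVec u) (latticeVec u') = latticeDet u u' := by
  simp [cross, latticeVec, latticeDet]

theorem latticeVec_ne_zero {u : ℤ × ℤ} (hu : IsCoprime u.1 u.2) : latticeVec u ≠ 0 := by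
  intro h
  have h1 := congrArg Prod.fst h
  have h2 := congrArg Prod.snd h
  simp only [latticeVec, Prod.fst_zero, Prod.snd_zero, Int.cast_eq_zero] at h1 h2
  rw [h1, h2] at hu
  exact not_isCoprime_zero_zero hu

/-- A vector parallel to a nonzero one is a multiple of it. -/
theorem exists_smul_of_cross_eq_zero {p q : Plane} (hp : p ≠ 0) (h : cross p q = 0) :
    ∃ t : ℝ, q = t • p := by
  have h' : p.1 * q.2 - p.2 * q.1 = 0 := h
  by_cases h1 : p.1 = 0
  · have h2 : p.2 ≠ 0 := fun h2 => hp (Prod.ext h1 h2)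
    refine ⟨q.2 / p.2, ?_⟩
    ext
    · simp only [h1, Prod.smul_fst, smul_eq_mul, mul_zero]
      rw [h1] at h'
      simpa [h2] using h'
    · simp [h2]
  · refine ⟨q.1 / p.1, ?_⟩
    ext
    · simp [h1]
    · simp only [Prod.smul_snd, smul_eq_mul]
      field_simp
      linarith

/-- Primitive lattice vectors on a common ray coincide. -/
theorem eq_of_smul_latticeVec_eq {u u' : ℤ × ℤ} (hu : IsCoprime u.1 u.2)
    (hu' : IsCoprime u'.1 u'.2) {t t' : ℝ} (ht : 0 < t) (ht' : 0 < t')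
    (h : t • latticeVec u = t' • latticeVec u') : u = u' := by
  have hc : cross (latticeVec u) (latticeVec u') = 0 := by
    have h1 : t' * cross (latticeVec u) (latticeVec u') = 0 := by
      rw [← cross_smul_right, ← h, cross_smul_right, cross_same, mul_zero]
    rcases mul_eq_zero.1 h1 with h2 | h2
    · exact absurd h2 ht'.ne'
    · exact h2
  rw [cross_latticeVec, Int.cast_eq_zero, latticeDet] at hc
  obtain ⟨a, b, hab⟩ := hu
  have h1 : u'.1 = (a * u'.1 + b * u'.2) * u.1 := by linear_combination (-u'.1) * hab - b * hc
  have h2 : u'.2 = (a * u'.1 + b * u'.2) * u.2 := by linear_combination (-u'.2) * hab + a * hc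
  obtain ⟨k, hk⟩ : ∃ k, k = a * u'.1 + b * u'.2 := ⟨_, rfl⟩
  rw [← hk] at h1 h2
  have hku : IsUnit k := hu'.isUnit_of_dvd' ⟨_, h1⟩ ⟨_, h2⟩
  have hu0 := latticeVec_ne_zero ⟨a, b, hab⟩
  have hv : latticeVec u' = (k : ℝ) • latticeVec u := by
    ext
    · simp only [latticeVec, Prod.smul_mk, smul_eq_mul]; exact_mod_cast h1
    · simp only [latticeVec, Prod.smul_mk, smul_eq_mul]; exact_mod_cast h2
  rw [hv, smul_smul] at h
  have htk : t = t' * k := smul_left_injective ℝ hu0 h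
  rcases Int.isUnit_iff.1 hku with rfl | rfl
  · exact Prod.ext (by simpa using h1.symm) (by simpa using h2.symm)
  · push_cast at htk; linarith

/-! ### Edges as parametrised segments and rays -/

namespace PlaneGraph

variable {Γ : PlaneGraph}

/-- Every edge is primitive, has at most one far end, and can be traversed backwards. -/
structure IsReversible (Γ : PlaneGraph) : Prop where
  primitive : ∀ v, ∀ u ∈ Γ.star v, IsCoprime u.1 u.2
  heads_unique : ∀ v u w w', Γ.HeadsTo v u w → Γ.HeadsTo v u w' → w = w'
  heads_symm : ∀ v u w, Γ.HeadsTo v u w → Γ.HeadsTo w (-u) v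

/-- The parameters `t` for which `pos v + t u` is on the closed edge emanating from `v` in
direction `u`. -/
def reach (Γ : PlaneGraph) (v : Fin Γ.n) (u : ℤ × ℤ) : Set ℝ :=
  {t | 0 ≤ t ∧ ∀ w s, Γ.HeadsTo v u w → Γ.pos w = Γ.pos v + s • latticeVec u → t ≤ s}

/-- The parameters `t` for which `pos v + t u` is in the relative interior of the edge. -/
def openReach (Γ : PlaneGraph) (v : Fin Γ.n) (u : ℤ × ℤ) : Set ℝ :=
  {t | 0 < t ∧ ∀ w s, Γ.HeadsTo v u w → Γ.pos w = Γ.pos v + s • latticeVec u → t < s}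

def closedEdge (Γ : PlaneGraph) (v : Fin Γ.n) (u : ℤ × ℤ) : Set Plane :=
  {x | ∃ t ∈ Γ.reach v u, x = Γ.pos v + t • latticeVec u}

def openEdge (Γ : PlaneGraph) (v : Fin Γ.n) (u : ℤ × ℤ) : Set Plane :=
  {x | ∃ t ∈ Γ.openReach v u, x = Γ.pos v + t • latticeVec u}

theorem openEdge_subset (v : Fin Γ.n) (u : ℤ × ℤ) : Γ.openEdge v u ⊆ Γ.closedEdge v u := by
  rintro x ⟨t, ⟨h0, h⟩, rfl⟩
  exact ⟨t, ⟨h0.le, fun w s hw hs => (h w s hw hs).le⟩, rfl⟩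

theorem heads_or_ray {v : Fin Γ.n} {u : ℤ × ℤ} (hu : u ∈ Γ.star v) :
    (∃ (w : Fin Γ.n) (s : ℝ), 0 < s ∧ Γ.HeadsTo v u w ∧ Γ.pos w = Γ.pos v + s • latticeVec u) ∨
      Γ.IsRay v u := by
  by_cases h : ∃ w, Γ.HeadsTo v u w
  · obtain ⟨w, hw⟩ := h
    obtain ⟨s, hs, hs'⟩ := hw.2.2
    exact Or.inl ⟨w, s, hs, hw, hs'⟩
  · exact Or.inr ⟨hu, fun w hw => h ⟨w, hw⟩⟩

theorem IsRay.reach_eq {v : Fin Γ.n} {u : ℤ × ℤ} (h : Γ.IsRay v u) :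
    Γ.reach v u = Set.Ici 0 := by
  ext t
  exact ⟨fun ht => ht.1, fun ht => ⟨ht, fun w _ hw => absurd hw (h.2 w)⟩⟩

theorem IsRay.openReach_eq {v : Fin Γ.n} {u : ℤ × ℤ} (h : Γ.IsRay v u) :
    Γ.openReach v u = Set.Ioi 0 := by
  ext t
  exact ⟨fun ht => ht.1, fun ht => ⟨ht, fun w _ hw => absurd hw (h.2 w)⟩⟩

theorem ordConnected_reach (v : Fin Γ.n) (u : ℤ × ℤ) : (Γ.reach v u).OrdConnected :=
  ⟨fun _ hx _ hy _ hz => ⟨hx.1.trans hz.1, fun w s hw hs => hz.2.trans (hy.2 w s hw hs)⟩⟩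

theorem mem_openReach_of_le {v : Fin Γ.n} {u : ℤ × ℤ} {t r : ℝ} (ht : t ∈ Γ.openReach v u)
    (h0 : 0 < r) (h : r ≤ t) : r ∈ Γ.openReach v u :=
  ⟨h0, fun w s hw hs => h.trans_lt (ht.2 w s hw hs)⟩

theorem isClosed_reach (v : Fin Γ.n) (u : ℤ × ℤ) : IsClosed (Γ.reach v u) := by
  have : Γ.reach v u = Set.Ici 0 ∩ ⋂ w, ⋂ s, ⋂ (_ : Γ.HeadsTo v u w),
      ⋂ (_ : Γ.pos w = Γ.pos v + s • latticeVec u), Set.Iic s := by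
    ext t; simp [reach]
  rw [this]
  exact isClosed_Ici.inter (isClosed_iInter fun _ => isClosed_iInter fun _ =>
    isClosed_iInter fun _ => isClosed_iInter fun _ => isClosed_Iic)

theorem mem_closedEdge_cases {v : Fin Γ.n} {u : ℤ × ℤ} {x : Plane}
    (hx : x ∈ Γ.closedEdge v u) :
    x ∈ Γ.openEdge v u ∨ x = Γ.pos v ∨ ∃ w, Γ.HeadsTo v u w ∧ x = Γ.pos w := by
  obtain ⟨t, ht, rfl⟩ := hx
  rcases ht.1.eq_or_lt with h0 | h0
  · right; left; simp [← h0]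
  by_cases hw : ∃ w, Γ.HeadsTo v u w ∧ Γ.pos v + t • latticeVec u = Γ.pos w
  · exact Or.inr (Or.inr hw)
  · refine Or.inl ⟨t, ⟨h0, fun w s hh hs => lt_of_le_of_ne (ht.2 w s hh hs) ?_⟩, rfl⟩
    rintro rfl
    exact hw ⟨w, hh, hs.symm⟩

namespace IsReversible

variable (R : Γ.IsReversible)
include R

theorem ne_zero {v : Fin Γ.n} {u : ℤ × ℤ} (hu : u ∈ Γ.star v) : latticeVec u ≠ 0 :=
  latticeVec_ne_zero (R.primitive v u hu)

theorem heads_length {v w w' : Fin Γ.n} {u : ℤ × ℤ} (h : Γ.HeadsTo v u w)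
    (h' : Γ.HeadsTo v u w') {s s' : ℝ} (hs : Γ.pos w = Γ.pos v + s • latticeVec u)
    (hs' : Γ.pos w' = Γ.pos v + s' • latticeVec u) : s = s' := by
  obtain rfl := R.heads_unique _ _ _ _ h h'
  exact smul_left_injective ℝ (R.ne_zero h.1) (add_left_cancel (hs.symm.trans hs'))

theorem reach_eq {v w : Fin Γ.n} {u : ℤ × ℤ} (h : Γ.HeadsTo v u w) {s : ℝ}
    (hs : Γ.pos w = Γ.pos v + s • latticeVec u) : Γ.reach v u = Set.Icc 0 s := by
  ext t
  refine ⟨fun ht => ⟨ht.1, ht.2 w s h hs⟩, fun ht => ⟨ht.1, fun w' s' h' hs' => ?_⟩⟩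
  rw [← R.heads_length h h' hs hs']; exact ht.2

theorem openReach_eq {v w : Fin Γ.n} {u : ℤ × ℤ} (h : Γ.HeadsTo v u w) {s : ℝ}
    (hs : Γ.pos w = Γ.pos v + s • latticeVec u) : Γ.openReach v u = Set.Ioo 0 s := by
  ext t
  refine ⟨fun ht => ⟨ht.1, ht.2 w s h hs⟩, fun ht => ⟨ht.1, fun w' s' h' hs' => ?_⟩⟩
  rw [← R.heads_length h h' hs hs']; exact ht.2

theorem zero_mem_reach {v : Fin Γ.n} {u : ℤ × ℤ} (hu : u ∈ Γ.star v) : 0 ∈ Γ.reach v u := by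
  rcases heads_or_ray hu with ⟨w, s, hs, hw, hws⟩ | h
  · rw [R.reach_eq hw hws]; exact ⟨le_rfl, hs.le⟩
  · rw [h.reach_eq]; exact Set.mem_Ici.2 le_rfl

theorem pos_mem_closedEdge {v : Fin Γ.n} {u : ℤ × ℤ} (hu : u ∈ Γ.star v) :
    Γ.pos v ∈ Γ.closedEdge v u := ⟨0, R.zero_mem_reach hu, by simp⟩

theorem eventually_mem_openReach {v : Fin Γ.n} {u : ℤ × ℤ} (hu : u ∈ Γ.star v) :
    ∃ r : ℝ, 0 < r ∧ ∀ t, 0 < t → t < r → t ∈ Γ.openReach v u := by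
  rcases heads_or_ray hu with ⟨w, s, hs, hw, hws⟩ | h
  · exact ⟨s, hs, fun t h0 h1 => by rw [R.openReach_eq hw hws]; exact ⟨h0, h1⟩⟩
  · exact ⟨1, one_pos, fun t h0 _ => by rw [h.openReach_eq]; exact h0⟩

theorem closedEdge_reverse {v w : Fin Γ.n} {u : ℤ × ℤ} (h : Γ.HeadsTo v u w) :
    Γ.closedEdge w (-u) = Γ.closedEdge v u := by
  obtain ⟨s, hs, hws⟩ := h.2.2
  have hr := R.heads_symm _ _ _ h
  have hvs : Γ.pos v = Γ.pos w + s • latticeVec (-u) := by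
    rw [hws, latticeVec_neg]; simp
  ext x
  simp only [closedEdge, R.reach_eq h hws, R.reach_eq hr hvs, Set.mem_ofPred_eq]
  constructor
  · rintro ⟨t, ⟨h0, h1⟩, rfl⟩
    refine ⟨s - t, ⟨by linarith, by linarith⟩, ?_⟩
    rw [hws, latticeVec_neg, sub_smul, smul_neg]; abel
  · rintro ⟨t, ⟨h0, h1⟩, rfl⟩
    refine ⟨s - t, ⟨by linarith, by linarith⟩, ?_⟩
    rw [hws, latticeVec_neg, smul_neg, sub_smul]; abel

theorem openEdge_reverse {v w : Fin Γ.n} {u : ℤ × ℤ} (h : Γ.HeadsTo v u w) :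
    Γ.openEdge w (-u) = Γ.openEdge v u := by
  obtain ⟨s, hs, hws⟩ := h.2.2
  have hr := R.heads_symm _ _ _ h
  have hvs : Γ.pos v = Γ.pos w + s • latticeVec (-u) := by
    rw [hws, latticeVec_neg]; simp
  ext x
  simp only [openEdge, R.openReach_eq h hws, R.openReach_eq hr hvs, Set.mem_ofPred_eq]
  constructor
  · rintro ⟨t, ⟨h0, h1⟩, rfl⟩
    refine ⟨s - t, ⟨by linarith, by linarith⟩, ?_⟩
    rw [hws, latticeVec_neg, sub_smul, smul_neg]; abel
  · rintro ⟨t, ⟨h0, h1⟩, rfl⟩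
    refine ⟨s - t, ⟨by linarith, by linarith⟩, ?_⟩
    rw [hws, latticeVec_neg, smul_neg, sub_smul]; abel

theorem pos_mem_closedEdge_of_heads {v w : Fin Γ.n} {u : ℤ × ℤ} (h : Γ.HeadsTo v u w) :
    Γ.pos w ∈ Γ.closedEdge v u := by
  rw [← R.closedEdge_reverse h]
  exact R.pos_mem_closedEdge (R.heads_symm _ _ _ h).1

theorem openSegment_eq_openEdge {v w : Fin Γ.n} {u : ℤ × ℤ} (h : Γ.HeadsTo v u w) :
    openSegment ℝ (Γ.pos v) (Γ.pos w) = Γ.openEdge v u := by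
  obtain ⟨s, hs, hws⟩ := h.2.2
  ext x
  rw [openSegment_eq_image']
  simp only [openEdge, R.openReach_eq h hws, Set.mem_image, Set.mem_ofPred_eq, hws,
    add_sub_cancel_left, smul_smul]
  constructor
  · rintro ⟨t, ⟨h0, h1⟩, rfl⟩
    exact ⟨t * s, ⟨mul_pos h0 hs, by nlinarith⟩, rfl⟩
  · rintro ⟨t, ⟨h0, h1⟩, rfl⟩
    exact ⟨t / s, ⟨div_pos h0 hs, (div_lt_one hs).2 h1⟩, by rw [div_mul_cancel₀ _ hs.ne']⟩

/-- This removes the distinction between segments and rays: every edge is handled through its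
parameter set from one end. -/
theorem isOpenEdge_iff {e : Set Plane} {u : ℤ × ℤ} :
    Γ.IsOpenEdge e u ↔ ∃ v, u ∈ Γ.star v ∧ e = Γ.openEdge v u := by
  have hray : ∀ v, Γ.IsRay v u →
      Γ.openEdge v u = {x | ∃ t : ℝ, 0 < t ∧ x = Γ.pos v + t • latticeVec u} := by
    intro v hv
    simp only [openEdge, hv.openReach_eq, Set.mem_Ioi]
  constructor
  · rintro (⟨v, w, h, rfl⟩ | ⟨v, h, rfl⟩)
    · exact ⟨v, h.1, R.openSegment_eq_openEdge h⟩
    · exact ⟨v, h.1, (hray v h).symm⟩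
  · rintro ⟨v, hu, rfl⟩
    rcases heads_or_ray hu with ⟨w, _, _, h, _⟩ | h
    · exact Or.inl ⟨v, w, h, (R.openSegment_eq_openEdge h).symm⟩
    · exact Or.inr ⟨v, h, hray v h⟩

/-- Nonempty stars are needed because a vertex without edges would belong to the support but to no
closed edge. -/
theorem mem_support_iff (hne : ∀ v, (Γ.star v).Nonempty) {x : Plane} :
    x ∈ Γ.support ↔ ∃ v, ∃ u ∈ Γ.star v, x ∈ Γ.closedEdge v u := by
  constructor
  · rintro (⟨v, rfl⟩ | ⟨e, u, he, hx⟩)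
    · obtain ⟨u, hu⟩ := hne v
      exact ⟨v, u, hu, R.pos_mem_closedEdge hu⟩
    · obtain ⟨v, hu, rfl⟩ := R.isOpenEdge_iff.1 he
      exact ⟨v, u, hu, openEdge_subset v u hx⟩
  · rintro ⟨v, u, hu, hx⟩
    rcases mem_closedEdge_cases hx with h | h | ⟨w, -, h⟩
    · exact Or.inr ⟨_, u, R.isOpenEdge_iff.2 ⟨v, hu, rfl⟩, h⟩
    · exact Or.inl ⟨v, h⟩
    · exact Or.inl ⟨w, h⟩

end IsReversible

/-- `(z, a)` and `(v, u)` describe the same edge, possibly from opposite ends. -/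
def SameEdge (Γ : PlaneGraph) (z : Fin Γ.n) (a : ℤ × ℤ) (v : Fin Γ.n) (u : ℤ × ℤ) : Prop :=
  (z = v ∧ a = u) ∨ (Γ.HeadsTo v u z ∧ a = -u)

namespace IsReversible

variable (R : Γ.IsReversible)
include R

theorem closedEdge_eq {z v : Fin Γ.n} {a u : ℤ × ℤ} (h : Γ.SameEdge z a v u) :
    Γ.closedEdge z a = Γ.closedEdge v u := by
  rcases h with ⟨rfl, rfl⟩ | ⟨h, rfl⟩
  · rfl
  · exact R.closedEdge_reverse h

theorem openEdge_eq {z v : Fin Γ.n} {a u : ℤ × ℤ} (h : Γ.SameEdge z a v u) :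
    Γ.openEdge z a = Γ.openEdge v u := by
  rcases h with ⟨rfl, rfl⟩ | ⟨h, rfl⟩
  · rfl
  · exact R.openEdge_reverse h

theorem mem_star {z v : Fin Γ.n} {a u : ℤ × ℤ} (h : Γ.SameEdge z a v u) (hu : u ∈ Γ.star v) :
    a ∈ Γ.star z := by
  rcases h with ⟨rfl, rfl⟩ | ⟨h, rfl⟩
  · exact hu
  · exact (R.heads_symm _ _ _ h).1

theorem eq_pos_of_mem_closedEdge {z : Fin Γ.n} {a a' : ℤ × ℤ} (ha : a ∈ Γ.star z)
    (ha' : a' ∈ Γ.star z) (hne : a ≠ a') {x : Plane} (hx : x ∈ Γ.closedEdge z a)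
    (hx' : x ∈ Γ.closedEdge z a') : x = Γ.pos z := by
  obtain ⟨t, ht, rfl⟩ := hx
  obtain ⟨t', ht', h⟩ := hx'
  have h' := add_left_cancel h
  rcases ht.1.eq_or_lt with h0 | h0
  · simp [← h0]
  rcases ht'.1.eq_or_lt with h0' | h0'
  · rw [h', ← h0']; simp
  · exact absurd (eq_of_smul_latticeVec_eq (R.primitive _ _ ha) (R.primitive _ _ ha') h0 h0' h') hne

end IsReversible

/-! ### Closed edges of a tropical curve meet only at common ends -/

namespace IsTropicalCurve

variable (h : Γ.IsTropicalCurve)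
include h

/-- Adjacency is symmetric, so some direction at `w` leads back to `v`; it is primitive and lies on
the ray of `-u`, hence equals `-u`. -/
theorem heads_symm {v w : Fin Γ.n} {u : ℤ × ℤ} (hw : Γ.HeadsTo v u w) :
    Γ.HeadsTo w (-u) v := by
  obtain ⟨u', hu'⟩ := h.adj_heads w v hw.2.1.symm
  obtain ⟨t, ht, h1⟩ := hw.2.2
  obtain ⟨t', ht', h2⟩ := hu'.2.2
  have key : t • latticeVec u = t' • latticeVec (-u') := by
    rw [latticeVec_neg, smul_neg]
    have : Γ.pos v = Γ.pos v + t • latticeVec u + t' • latticeVec u' := by rw [← h1, ← h2]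
    rw [add_assoc, left_eq_add] at this
    exact eq_neg_of_add_eq_zero_left this
  have hp := h.primitive _ _ hu'.1
  have : u = -u' := eq_of_smul_latticeVec_eq (h.primitive _ _ hw.1)
    (by simpa using hp.neg_neg) ht ht' key
  rw [this, neg_neg]
  exact hu'

/-- If there were two far ends at different distances, the nearer one would lie in the interior of
the longer edge. -/
theorem heads_unique {v w w' : Fin Γ.n} {u : ℤ × ℤ} (hw : Γ.HeadsTo v u w)
    (hw' : Γ.HeadsTo v u w') : w = w' := by
  obtain ⟨s, hs, h1⟩ := id hw.2.2
  obtain ⟨s', hs', h2⟩ := id hw'.2.2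
  have aux : ∀ {w w' : Fin Γ.n} {s s' : ℝ}, Γ.HeadsTo v u w' → 0 < s → s < s' →
      Γ.pos w = Γ.pos v + s • latticeVec u → Γ.pos w' = Γ.pos v + s' • latticeVec u → False := by
    intro w w' s s' hw' hs hlt h1 h2
    refine h.vertex_notMem _ u (Or.inl ⟨v, w', hw', rfl⟩) w ?_
    rw [openSegment_eq_image']
    refine ⟨s / s', ⟨div_pos hs (hs.trans hlt), (div_lt_one (hs.trans hlt)).2 hlt⟩, ?_⟩
    simp only
    rw [h2, add_sub_cancel_left, smul_smul, div_mul_cancel₀ _ (hs.trans hlt).ne', h1]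
  rcases lt_trichotomy s s' with hlt | rfl | hlt
  · exact (aux hw' hs hlt h1 h2).elim
  · exact h.pos_injective (h1.trans h2.symm)
  · exact (aux hw hs' hlt h2 h1).elim

theorem isReversible : Γ.IsReversible :=
  ⟨h.primitive, fun _ _ _ _ => h.heads_unique, fun _ _ _ => h.heads_symm⟩

/-- Closed edges that meet emanate from a common vertex, after reversing them if necessary. -/
theorem exists_common_base {v v' : Fin Γ.n} {u u' : ℤ × ℤ} (hu : u ∈ Γ.star v)
    (hu' : u' ∈ Γ.star v') {x : Plane} (hx : x ∈ Γ.closedEdge v u)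
    (hx' : x ∈ Γ.closedEdge v' u') :
    ∃ z a a', Γ.SameEdge z a v u ∧ Γ.SameEdge z a' v' u' := by
  have R := h.isReversible
  have endpt : ∀ {v : Fin Γ.n} {u : ℤ × ℤ} {x : Plane}, x ∈ Γ.closedEdge v u →
      x ∈ Γ.openEdge v u ∨ ∃ z a, Γ.SameEdge z a v u ∧ x = Γ.pos z := by
    intro v u x hx
    rcases mem_closedEdge_cases hx with h1 | h1 | ⟨w, hw, h1⟩
    · exact Or.inl h1
    · exact Or.inr ⟨v, u, Or.inl ⟨rfl, rfl⟩, h1⟩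
    · exact Or.inr ⟨w, -u, Or.inr ⟨hw, rfl⟩, h1⟩
  rcases endpt hx with h1 | ⟨z, a, hz, rfl⟩
  · rcases endpt hx' with h2 | ⟨z, a, hz, rfl⟩
    · have heq : Γ.openEdge v u = Γ.openEdge v' u' :=
        h.edge_disjoint _ u _ u' (R.isOpenEdge_iff.2 ⟨v, hu, rfl⟩)
          (R.isOpenEdge_iff.2 ⟨v', hu', rfl⟩) ⟨x, h1, h2⟩
      obtain ⟨t, ht, rfl⟩ := h1
      obtain ⟨t', ht', hxt⟩ := h2
      -- The two open edges coincide as sets. A second common point shows that their directions are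
      -- parallel.
      have hx2 : Γ.pos v + (t / 2) • latticeVec u ∈ Γ.openEdge v' u' := by
        rw [← heq]
        have h0 : 0 < t := ht.1
        exact ⟨t / 2, mem_openReach_of_le ht (by linarith) (by linarith), rfl⟩
      obtain ⟨r, hr, hxr⟩ := hx2
      have hpar : (t / 2) • latticeVec u = (t' - r) • latticeVec u' := by
        have : (Γ.pos v + t • latticeVec u) - (Γ.pos v + (t / 2) • latticeVec u) =
          (Γ.pos v' + t' • latticeVec u') - (Γ.pos v' + r • latticeVec u') := by rw [hxt, hxr]
        rw [add_sub_add_left_eq_sub, add_sub_add_left_eq_sub, ← sub_smul, ← sub_smul] at this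
        rwa [sub_half] at this
      have h0 : 0 < t := ht.1
      have h0' : 0 < t' := ht'.1
      have hnot := h.vertex_notMem _ u (R.isOpenEdge_iff.2 ⟨v, hu, rfl⟩)
      have hnot' := h.vertex_notMem _ u' (R.isOpenEdge_iff.2 ⟨v', hu', rfl⟩)
      -- The sign distinguishes opposite from equal directions. In both cases the ends must match,
      -- since otherwise some vertex would lie inside an edge.
      rcases lt_trichotomy (t' - r) 0 with hlt | hz | hgt
      · have huu : u = -u' := eq_of_smul_latticeVec_eq (h.primitive _ _ hu)
          (by simpa using (h.primitive _ _ hu').neg_neg) (half_pos h0) (neg_pos.2 hlt)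
          (by rw [hpar, latticeVec_neg, neg_smul_neg])
        obtain rfl : u' = -u := by rw [huu, neg_neg]
        have hv' : Γ.pos v' = Γ.pos v + (t + t') • latticeVec u := by
          rw [latticeVec_neg, smul_neg, ← sub_eq_add_neg] at hxt
          rw [add_smul, ← add_assoc, hxt, sub_add_cancel]
        rcases heads_or_ray hu with ⟨w, s, hs, hw, hws⟩ | hray
        · rcases lt_trichotomy (t + t') s with hl | he | hg
          · refine absurd ⟨t + t', ?_, hv'⟩ (hnot v')
            rw [R.openReach_eq hw hws]
            exact ⟨by linarith, hl⟩
          · obtain rfl : v' = w := h.pos_injective (by rw [hv', hws, he])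
            exact ⟨v', -u, -u, Or.inr ⟨hw, rfl⟩, Or.inl ⟨rfl, rfl⟩⟩
          · refine absurd ⟨t + t' - s, ?_, ?_⟩ (hnot' w)
            · have hts : t < s := ht.2 w s hw hws
              exact mem_openReach_of_le ht' (by linarith) (by linarith)
            · rw [hv', hws, latticeVec_neg, smul_neg, sub_smul]; abel
        · refine absurd ⟨t + t', ?_, hv'⟩ (hnot v')
          rw [hray.openReach_eq]
          exact add_pos h0 h0'
      · rw [hz, zero_smul] at hpar
        exact absurd hpar (smul_ne_zero (half_pos h0).ne' (R.ne_zero hu))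
      · obtain rfl : u = u' := eq_of_smul_latticeVec_eq (h.primitive _ _ hu)
          (h.primitive _ _ hu') (half_pos h0) hgt hpar
        rcases lt_trichotomy t t' with hl | he | hg
        · refine absurd ⟨t' - t, mem_openReach_of_le ht' (by linarith) (by linarith), ?_⟩ (hnot' v)
          rw [eq_sub_of_add_eq hxt, sub_smul]; abel
        · obtain rfl : v = v' := h.pos_injective (by rw [he] at hxt; exact add_right_cancel hxt)
          exact ⟨v, u, u, Or.inl ⟨rfl, rfl⟩, Or.inl ⟨rfl, rfl⟩⟩
        · refine absurd ⟨t - t', mem_openReach_of_le ht (by linarith) (by linarith), ?_⟩ (hnot v')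
          rw [eq_sub_of_add_eq hxt.symm, sub_smul]; abel
    · exact absurd h1 (h.vertex_notMem _ u (R.isOpenEdge_iff.2 ⟨v, hu, rfl⟩) z)
  · rcases endpt hx' with h2 | ⟨z', a', hz', hzz⟩
    · exact absurd h2 (h.vertex_notMem _ u' (R.isOpenEdge_iff.2 ⟨v', hu', rfl⟩) z)
    · obtain rfl := h.pos_injective hzz
      exact ⟨z, a, a', hz, hz'⟩

end IsTropicalCurve

end PlaneGraph


/-! ### Separation of disjoint edges and the choice of a small scale -/

theorem exists_norm_bound_of_rays_disjoint {a b : Plane} {u u' : ℤ × ℤ} (hu : IsCoprime u.1 u.2)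
    (hu' : IsCoprime u'.1 u'.2)
    (hd : ∀ t t' : ℝ, 0 ≤ t → 0 ≤ t' → a + t • latticeVec u ≠ b + t' • latticeVec u') :
    ∃ r : ℝ, 0 < r ∧ ∀ t t' : ℝ, 0 ≤ t → 0 ≤ t' →
      r ≤ ‖(a + t • latticeVec u) - (b + t' • latticeVec u')‖ := by
  have hu0 := latticeVec_ne_zero hu
  have hu0' := latticeVec_ne_zero hu'
  -- It suffices to enclose all differences of points in a closed set that misses `0`. For opposite
  -- rays on one line this is a half-line (rays with equal directions on one line would overlap),
  -- for rays on distinct parallel lines it is a line, and for transverse rays a translate of a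
  -- closed cone.
  have of_closed : ∀ C : Set Plane, IsClosed C → (0 : Plane) ∉ C →
      (∀ t t' : ℝ, 0 ≤ t → 0 ≤ t' → (a + t • latticeVec u) - (b + t' • latticeVec u') ∈ C) →
      ∃ r : ℝ, 0 < r ∧ ∀ t t' : ℝ, 0 ≤ t → 0 ≤ t' →
      r ≤ ‖(a + t • latticeVec u) - (b + t' • latticeVec u')‖ := by
    intro C hC h0 hmem
    obtain ⟨r, hr, hball⟩ := Metric.isOpen_iff.1 hC.isOpen_compl 0 h0
    refine ⟨r, hr, fun t t' ht ht' => ?_⟩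
    by_contra hlt
    exact hball (by simpa using not_le.1 hlt) (hmem t t' ht ht')
  by_cases hx : cross (latticeVec u) (latticeVec u') = 0
  · by_cases hab : cross (latticeVec u) (a - b) = 0
    · obtain ⟨s, hs⟩ := exists_smul_of_cross_eq_zero hu0 hab
      obtain ⟨k, hk⟩ := exists_smul_of_cross_eq_zero hu0 hx
      have hk0 : k ≠ 0 := by
        rintro rfl
        exact hu0' (by simpa using hk)
      have ha : a = b + s • latticeVec u := by rw [← hs]; abel
      rcases hk0.lt_or_gt with hneg | hpos
      · refine of_closed ((fun r : ℝ => r • latticeVec u) '' Set.Ici s) ?_ ?_ ?_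
        · have hinj : Function.Injective ((LinearMap.id : ℝ →ₗ[ℝ] ℝ).smulRight (latticeVec u)) :=
            fun x y hxy => smul_left_injective ℝ hu0 hxy
          exact (LinearMap.isClosedEmbedding_of_injective
            (LinearMap.ker_eq_bot.2 hinj)).isClosedMap _ isClosed_Ici
        · rintro ⟨r, hr, h0⟩
          have hr0 : r = 0 := by
            rcases smul_eq_zero.1 h0 with h | h
            · exact h
            · exact absurd h hu0
          have hs0 : s ≤ 0 := by simpa [hr0] using hr
          refine hd (-s) 0 (by linarith) le_rfl ?_
          rw [ha]; simp
        · intro t t' ht ht'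
          refine ⟨s + t - t' * k, ?_, ?_⟩
          · have : 0 ≤ t' * (-k) := mul_nonneg ht' (by linarith)
            simp only [Set.mem_Ici]; linarith
          · simp only
            rw [ha, hk, smul_smul, sub_smul, add_smul]; abel
      · exfalso
        rcases le_total 0 s with h0 | h0
        · refine hd 0 (s / k) le_rfl (div_nonneg h0 hpos.le) ?_
          rw [ha, hk, smul_smul, div_mul_cancel₀ _ hk0]; simp
        · refine hd (-s) 0 (by linarith) le_rfl ?_
          rw [ha]; simp
    · refine of_closed {x | cross (latticeVec u) x = cross (latticeVec u) (a - b)} ?_ ?_ ?_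
      · exact isClosed_eq (continuous_cross _) continuous_const
      · intro h0
        exact hab (by rw [← h0.out, cross_zero_right])
      · intro t t' _ _
        simp only [Set.mem_ofPred_eq]
        simp only [cross_sub_right, cross_add_right, cross_smul_right, cross_same, hx]
        ring
  · refine of_closed ((fun x : ℝ × ℝ => (a - b) + (x.1 • latticeVec u - x.2 • latticeVec u')) ''
      (Set.Ici 0 ×ˢ Set.Ici 0)) ?_ ?_ ?_
    · let f : ℝ × ℝ →ₗ[ℝ] Plane :=
        (LinearMap.fst ℝ ℝ ℝ).smulRight (latticeVec u) -
          (LinearMap.snd ℝ ℝ ℝ).smulRight (latticeVec u')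
      have hinj : LinearMap.ker f = ⊥ := by
        rw [LinearMap.ker_eq_bot']
        rintro ⟨t, t'⟩ h0
        have h0' : t • latticeVec u - t' • latticeVec u' = 0 := h0
        have h1 := congrArg (cross (latticeVec u)) h0'
        have h2 := congrArg (cross (latticeVec u')) h0'
        simp only [cross_sub_right, cross_smul_right, cross_same, cross_zero_right] at h1 h2
        rw [cross_comm (latticeVec u')] at h2
        ext
        · simpa [hx] using h2
        · simpa [hx] using h1
      have hcl := (LinearMap.isClosedEmbedding_of_injective hinj).isClosedMap _
        ((isClosed_Ici (a := (0 : ℝ))).prod (isClosed_Ici (a := (0 : ℝ))))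
      have := (Homeomorph.addLeft (a - b)).isClosedMap _ hcl
      rwa [Set.image_image] at this
    · rintro ⟨⟨t, t'⟩, ⟨ht, ht'⟩, h0⟩
      refine hd t t' ht ht' ?_
      simp only at h0
      rw [← sub_eq_zero, ← h0]; abel
    · intro t t' ht ht'
      exact ⟨(t, t'), ⟨ht, ht'⟩, by simp only; abel⟩

namespace PlaneGraph

variable {Γ : PlaneGraph}

theorem IsReversible.isClosed_closedEdge (R : Γ.IsReversible) {v : Fin Γ.n} {u : ℤ × ℤ}
    (hu : u ∈ Γ.star v) : IsClosed (Γ.closedEdge v u) := by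
  have hinj : Function.Injective ((LinearMap.id : ℝ →ₗ[ℝ] ℝ).smulRight (latticeVec u)) :=
    fun x y hxy => smul_left_injective ℝ (R.ne_zero hu) hxy
  have hcl := (LinearMap.isClosedEmbedding_of_injective
            (LinearMap.ker_eq_bot.2 hinj)).isClosedMap _ (isClosed_reach v u)
  have := (Homeomorph.addLeft (Γ.pos v)).isClosedMap _ hcl
  rw [Set.image_image] at this
  convert this using 1
  ext x
  simp [closedEdge, eq_comm]

theorem IsReversible.isCompact_closedEdge (R : Γ.IsReversible) {v w : Fin Γ.n} {u : ℤ × ℤ}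
    (h : Γ.HeadsTo v u w) : IsCompact (Γ.closedEdge v u) := by
  obtain ⟨s, -, hs⟩ := h.2.2
  have : Γ.closedEdge v u = (fun t : ℝ => Γ.pos v + t • latticeVec u) '' Set.Icc 0 s := by
    ext x
    simp only [closedEdge, R.reach_eq h hs, Set.mem_image, Set.mem_ofPred_eq, eq_comm]
  rw [this]
  exact isCompact_Icc.image (by fun_prop)

/-- Compactness suffices if one of the edges is bounded. Two rays need the separate argument,
because disjoint closed sets can approach each other at infinity. -/
theorem IsReversible.exists_edge_separation (R : Γ.IsReversible) {v v' : Fin Γ.n} {u u' : ℤ × ℤ}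
    (hu : u ∈ Γ.star v) (hu' : u' ∈ Γ.star v')
    (hd : Disjoint (Γ.closedEdge v u) (Γ.closedEdge v' u')) :
    ∃ r : ℝ, 0 < r ∧ ∀ x ∈ Γ.closedEdge v u, ∀ y ∈ Γ.closedEdge v' u', r ≤ ‖x - y‖ := by
  have compact_case : ∀ {v v' : Fin Γ.n} {u u' : ℤ × ℤ}, IsCompact (Γ.closedEdge v u) →
      u' ∈ Γ.star v' → Disjoint (Γ.closedEdge v u) (Γ.closedEdge v' u') →
      ∃ r : ℝ, 0 < r ∧ ∀ x ∈ Γ.closedEdge v u, ∀ y ∈ Γ.closedEdge v' u', r ≤ ‖x - y‖ := by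
    intro v v' u u' hc hu' hd
    obtain ⟨r, hr, hdis⟩ := hd.exists_thickenings hc (R.isClosed_closedEdge hu')
    refine ⟨r, hr, fun x hx y hy => ?_⟩
    by_contra hlt
    refine Set.disjoint_left.1 hdis (Metric.self_subset_thickening hr _ hx)
      (Metric.mem_thickening_iff.2 ⟨y, hy, ?_⟩)
    rw [dist_eq_norm]
    exact not_le.1 hlt
  rcases heads_or_ray hu with ⟨w, _, _, hw, _⟩ | hray
  · exact compact_case (R.isCompact_closedEdge hw) hu' hd
  rcases heads_or_ray hu' with ⟨w, _, _, hw, _⟩ | hray'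
  · obtain ⟨r, hr, h⟩ := compact_case (R.isCompact_closedEdge hw) hu hd.symm
    exact ⟨r, hr, fun x hx y hy => by rw [norm_sub_rev]; exact h y hy x hx⟩
  · obtain ⟨r, hr, h⟩ := exists_norm_bound_of_rays_disjoint (a := Γ.pos v) (b := Γ.pos v')
      (R.primitive _ _ hu) (R.primitive _ _ hu') (by
        intro t t' ht ht' heq
        refine Set.disjoint_left.1 hd ⟨t, ?_, rfl⟩ ⟨t', ?_, heq⟩
        · rw [hray.reach_eq]; exact ht
        · rw [hray'.reach_eq]; exact ht')
    refine ⟨r, hr, ?_⟩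
    rintro x ⟨t, ht, rfl⟩ y ⟨t', ht', rfl⟩
    exact h t t' ht.1 ht'.1

/-- Displacements of size `η` are small compared to the features of the drawing. -/
structure IsSmallScale (Γ : PlaneGraph) (η : ℝ) : Prop where
  pos : 0 < η
  vertex : ∀ v w, v ≠ w → 8 * η ≤ ‖Γ.pos w - Γ.pos v‖
  edge : ∀ v v', ∀ u ∈ Γ.star v, ∀ u' ∈ Γ.star v',
    Disjoint (Γ.closedEdge v u) (Γ.closedEdge v' u') →
      ∀ x ∈ Γ.closedEdge v u, ∀ y ∈ Γ.closedEdge v' u', 2 * η ≤ ‖x - y‖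

theorem IsTropicalCurve.exists_isSmallScale (h : Γ.IsTropicalCurve) :
    ∃ η, Γ.IsSmallScale η := by
  have hsmall : ∀ {C r : ℝ}, 0 < C → 0 < r → ∀ᶠ η : ℝ in 𝓝[>] 0, C * η ≤ r := by
    intro C r hC hr
    filter_upwards [Ioo_mem_nhdsGT (div_pos hr hC)] with η hη
    have := hη.2.le
    rw [le_div_iff₀ hC] at this
    linarith
  have h1 : ∀ᶠ η : ℝ in 𝓝[>] 0, ∀ v w, v ≠ w → 8 * η ≤ ‖Γ.pos w - Γ.pos v‖ := by
    simp only [eventually_all]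
    intro v w hvw
    exact hsmall (by norm_num) (norm_pos_iff.2 (sub_ne_zero.2 fun hh => hvw (h.pos_injective hh.symm)))
  have h2 : ∀ᶠ η : ℝ in 𝓝[>] 0, ∀ v v', ∀ u ∈ Γ.star v, ∀ u' ∈ Γ.star v',
      Disjoint (Γ.closedEdge v u) (Γ.closedEdge v' u') →
      ∀ x ∈ Γ.closedEdge v u, ∀ y ∈ Γ.closedEdge v' u', 2 * η ≤ ‖x - y‖ := by
    simp only [eventually_all, Filter.eventually_all_finset]
    intro v v' u hu u' hu' hd
    obtain ⟨r, hr, hrr⟩ := h.isReversible.exists_edge_separation hu hu' hd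
    filter_upwards [hsmall two_pos hr] with η hη x hx y hy
    exact hη.trans (hrr x hx y hy)
  obtain ⟨η, h0, h1, h2⟩ := (eventually_mem_nhdsWithin.and (h1.and h2)).exists
  exact ⟨η, h0, h1, h2⟩

/-! ### Small slope-preserving deformations -/

/-- The same combinatorial graph with displaced vertices. -/
def deform (Γ : PlaneGraph) (δ : Fin Γ.n → Plane) : PlaneGraph where
  n := Γ.n
  pos := fun v => Γ.pos v + δ v
  graph := Γ.graph
  star := Γ.star

/-- The displacements of the vertices that preserve the slopes of the bounded edges. -/
def slopeSpace (Γ : PlaneGraph) : Submodule ℝ (Fin Γ.n → Plane) where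
  carrier := {δ | ∀ v w, Γ.graph.Adj v w → cross (Γ.pos w - Γ.pos v) (δ w - δ v) = 0}
  add_mem' := by
    intro δ δ' h h' v w hvw
    have h1 := h v w hvw
    have h2 := h' v w hvw
    rw [cross_sub_right] at h1 h2 ⊢
    rw [Pi.add_apply, Pi.add_apply, cross_add_right, cross_add_right]
    linarith
  zero_mem' := by intro v w _; simp
  smul_mem' := by
    intro r δ h v w hvw
    have h1 := h v w hvw
    rw [Pi.smul_apply, Pi.smul_apply, ← smul_sub, cross_smul_right, h1, mul_zero]

theorem const_mem_slopeSpace (c : Plane) : (fun _ => c) ∈ Γ.slopeSpace := by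
  intro v w _; simp

/-- Both ends of an edge are pushed sideways by the same amount. This is how motion propagates along
a strand. -/
theorem cross_eq_of_heads {δ : Fin Γ.n → Plane} (hδ : δ ∈ Γ.slopeSpace) {v w : Fin Γ.n}
    {u : ℤ × ℤ} (h : Γ.HeadsTo v u w) :
    cross (latticeVec u) (δ w) = cross (latticeVec u) (δ v) := by
  obtain ⟨t, ht, hw⟩ := h.2.2
  have h1 := hδ v w h.2.1
  rw [hw, add_sub_cancel_left, cross_smul_left, cross_sub_right] at h1
  have := (mul_eq_zero.1 h1).resolve_left ht.ne'
  linarith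

theorem IsTropicalCurve.exists_common_base_of_near (h : Γ.IsTropicalCurve) {η : ℝ}
    (hη : Γ.IsSmallScale η) {v v' : Fin Γ.n} {u u' : ℤ × ℤ} (hu : u ∈ Γ.star v)
    (hu' : u' ∈ Γ.star v') {x y : Plane} (hx : x ∈ Γ.closedEdge v u)
    (hy : y ∈ Γ.closedEdge v' u') (hxy : ‖x - y‖ < 2 * η) :
    ∃ z a a', Γ.SameEdge z a v u ∧ Γ.SameEdge z a' v' u' := by
  by_cases hd : Disjoint (Γ.closedEdge v u) (Γ.closedEdge v' u')
  · exact absurd (hη.edge v v' u hu u' hu' hd x hx y hy) (not_le.2 hxy)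
  · obtain ⟨p, hp, hp'⟩ := Set.not_disjoint_iff.1 hd
    exact h.exists_common_base hu hu' hp hp'

section Deform

variable (h : Γ.IsTropicalCurve) {η : ℝ} (hη : Γ.IsSmallScale η) {δ : Fin Γ.n → Plane}
  (hδ : δ ∈ Γ.slopeSpace) (hs : ∀ v, ‖δ v‖ < η)
include h hη hδ hs

/-- The edge vector changes by a multiple of `u` of norm less than `2η`, while its length is at
least `8η`; so it cannot collapse or flip. -/
theorem exists_deform_length {v w : Fin Γ.n} {u : ℤ × ℤ} (hw : Γ.HeadsTo v u w) :
    ∃ s : ℝ, 0 < s ∧ (Γ.deform δ).pos w = (Γ.deform δ).pos v + s • latticeVec u := by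
  have R := h.isReversible
  obtain ⟨t, ht, hwt⟩ := hw.2.2
  have hc : cross (latticeVec u) (δ w - δ v) = 0 := by
    rw [cross_sub_right, cross_eq_of_heads hδ hw, sub_self]
  obtain ⟨s, hss⟩ := exists_smul_of_cross_eq_zero (R.ne_zero hw.1) hc
  refine ⟨t + s, ?_, ?_⟩
  · have h1 := hη.vertex v w hw.2.1.ne
    have h2 : ‖δ w - δ v‖ < 2 * η := by
      have := norm_sub_le (δ w) (δ v)
      linarith [hs v, hs w]
    rw [hwt, add_sub_cancel_left, norm_smul, Real.norm_of_nonneg ht.le] at h1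
    rw [hss, norm_smul] at h2
    have h3 : ‖s‖ * ‖latticeVec u‖ < t * ‖latticeVec u‖ := by linarith [hη.pos]
    have h4 := lt_of_mul_lt_mul_right h3 (norm_nonneg _)
    have := neg_abs_le s
    rw [Real.norm_eq_abs] at h4
    linarith
  · change Γ.pos w + δ w = Γ.pos v + δ v + (t + s) • latticeVec u
    rw [eq_add_of_sub_eq hss, hwt, add_smul]; abel

theorem deform_headsTo_iff {v w : Fin Γ.n} {u : ℤ × ℤ} :
    (Γ.deform δ).HeadsTo v u w ↔ Γ.HeadsTo v u w := by
  constructor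
  · rintro ⟨hu, hadj, t, ht, hw⟩
    obtain ⟨u0, hu0⟩ := h.adj_heads v w hadj
    obtain ⟨s, hs0, hws⟩ := exists_deform_length h hη hδ hs hu0
    have := eq_of_smul_latticeVec_eq (h.primitive v u hu) (h.primitive v u0 hu0.1) ht hs0
      (add_left_cancel (hw.symm.trans hws))
    rwa [this]
  · intro hw
    exact ⟨hw.1, hw.2.1, exists_deform_length h hη hδ hs hw⟩

theorem deform_isReversible : (Γ.deform δ).IsReversible where
  primitive := h.primitive
  heads_unique := fun _ _ _ _ h1 h2 => h.heads_unique
    ((deform_headsTo_iff h hη hδ hs).1 h1) ((deform_headsTo_iff h hη hδ hs).1 h2)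
  heads_symm := fun _ _ _ h1 => (deform_headsTo_iff h hη hδ hs).2
    (h.heads_symm ((deform_headsTo_iff h hη hδ hs).1 h1))

theorem deform_sameEdge {z v : Fin Γ.n} {a u : ℤ × ℤ} (hz : Γ.SameEdge z a v u) :
    (Γ.deform δ).SameEdge z a v u :=
  hz.imp_right fun h' => ⟨(deform_headsTo_iff h hη hδ hs).2 h'.1, h'.2⟩

/-- On a bounded edge, compare the points that divide the old and the new edge in the same ratio:
their difference is a convex combination of `δ v` and `δ w`. On a ray, compare equal parameters. -/
theorem exists_near_of_mem_deform {v : Fin Γ.n} {u : ℤ × ℤ} (hu : u ∈ Γ.star v) {x : Plane}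
    (hx : x ∈ (Γ.deform δ).closedEdge v u) : ∃ y ∈ Γ.closedEdge v u, ‖x - y‖ < η := by
  have R := h.isReversible
  have R' := deform_isReversible h hη hδ hs
  obtain ⟨t, ht, rfl⟩ := hx
  rcases heads_or_ray hu with ⟨w, s, hs0, hw, hws⟩ | hray
  · obtain ⟨s', hs', hws'⟩ := exists_deform_length h hη hδ hs hw
    rw [R'.reach_eq ((deform_headsTo_iff h hη hδ hs).2 hw) hws'] at ht
    have h0 : 0 ≤ t / s' := div_nonneg ht.1 hs'.le
    have h1 : t / s' ≤ 1 := (div_le_one hs').2 ht.2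
    refine ⟨Γ.pos v + (t / s' * s) • latticeVec u, ⟨_, ?_, rfl⟩, ?_⟩
    · rw [R.reach_eq hw hws]
      exact ⟨mul_nonneg h0 hs0.le, by nlinarith⟩
    · have e1 : t • latticeVec u = (t / s') • (s' • latticeVec u) := by
        rw [smul_smul, div_mul_cancel₀ _ hs'.ne']
      have e2 : s' • latticeVec u = s • latticeVec u + δ w - δ v := by
        have e3 : Γ.pos w + δ w = Γ.pos v + δ v + s' • latticeVec u := hws'
        rw [hws, add_assoc, add_assoc, add_right_inj] at e3
        rw [e3]; abel
      have e4 : (Γ.deform δ).pos v + t • latticeVec u -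
          (Γ.pos v + (t / s' * s) • latticeVec u) = (1 - t / s') • δ v + (t / s') • δ w := by
        change Γ.pos v + δ v + t • latticeVec u - _ = _
        rw [e1, e2, smul_sub, smul_add, sub_smul, one_smul, smul_smul]; abel
      rw [e4]
      have := convex_ball (0 : Plane) η (x := δ v) (by simpa using hs v) (y := δ w)
        (by simpa using hs w) (sub_nonneg.2 h1) h0 (by ring)
      simpa using this
  · refine ⟨Γ.pos v + t • latticeVec u, ⟨t, ?_, rfl⟩, ?_⟩
    · rw [hray.reach_eq]; exact ht.1
    · change ‖Γ.pos v + δ v + t • latticeVec u - _‖ < η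
      have : Γ.pos v + δ v + t • latticeVec u - (Γ.pos v + t • latticeVec u) = δ v := by abel
      rw [this]; exact hs v

/-- Two deformed edges that meet come from original edges at distance less than `2η`, which cannot
be disjoint at this scale. All incidences therefore reduce to edges at a single vertex. -/
theorem exists_common_base_of_deform {v v' : Fin Γ.n} {u u' : ℤ × ℤ} (hu : u ∈ Γ.star v)
    (hu' : u' ∈ Γ.star v') {x : Plane} (hx : x ∈ (Γ.deform δ).closedEdge v u)
    (hx' : x ∈ (Γ.deform δ).closedEdge v' u') :
    ∃ z a a', Γ.SameEdge z a v u ∧ Γ.SameEdge z a' v' u' := by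
  obtain ⟨y, hy, hxy⟩ := exists_near_of_mem_deform h hη hδ hs hu hx
  obtain ⟨y', hy', hxy'⟩ := exists_near_of_mem_deform h hη hδ hs hu' hx'
  refine h.exists_common_base_of_near hη hu hu' hy hy' ?_
  have := norm_sub_le_norm_sub_add_norm_sub y x y'
  rw [norm_sub_rev y x] at this
  linarith

/-- Small slope-preserving displacements of a tropical curve are tropical curves. -/
theorem deform_isTropicalCurve : (Γ.deform δ).IsTropicalCurve where
  nonempty := h.nonempty
  pos_injective := by
    intro v w hvw
    by_contra hne
    have h1 := hη.vertex v w hne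
    have h2 : Γ.pos v + δ v = Γ.pos w + δ w := hvw
    have h3 : Γ.pos w - Γ.pos v = δ v - δ w := by
      rw [sub_eq_sub_iff_add_eq_add, ← h2]; abel
    have := norm_sub_le (δ v) (δ w)
    rw [h3] at h1
    linarith [hs v, hs w, hη.pos]
  star_nonempty := h.star_nonempty
  primitive := h.primitive
  adj_heads := by
    intro v w hvw
    obtain ⟨u, hu⟩ := h.adj_heads v w hvw
    exact ⟨u, (deform_headsTo_iff h hη hδ hs).2 hu⟩
  vertex_notMem := by
    intro e u he v hv
    have R' := deform_isReversible h hη hδ hs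
    obtain ⟨v', hu, rfl⟩ := R'.isOpenEdge_iff.1 he
    obtain ⟨u0, hu0⟩ := h.star_nonempty v
    obtain ⟨z, a, a', hz, hz'⟩ := exists_common_base_of_deform h hη hδ hs hu hu0
      (openEdge_subset _ _ hv) (R'.pos_mem_closedEdge hu0)
    rw [← R'.openEdge_eq (deform_sameEdge h hη hδ hs hz)] at hv
    obtain ⟨t, ht, hvt⟩ := hv
    have haz : a ∈ Γ.star z := h.isReversible.mem_star hz hu
    rcases hz' with ⟨rfl, rfl⟩ | ⟨hvz, rfl⟩
    · rw [left_eq_add] at hvt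
      exact (smul_ne_zero ht.1.ne' (R'.ne_zero haz)) hvt
    · have hzv := (deform_headsTo_iff h hη hδ hs).2 (h.heads_symm hvz)
      obtain ⟨s, hs0, hvs⟩ := id hzv.2.2
      obtain rfl : a = -u0 := eq_of_smul_latticeVec_eq (h.primitive _ _ haz)
        (h.primitive _ _ hzv.1) ht.1 hs0 (add_left_cancel (hvt.symm.trans hvs))
      have h1 := ht.2 v s hzv hvs
      have h2 := smul_left_injective ℝ (R'.ne_zero hzv.1) (add_left_cancel (hvt.symm.trans hvs))
      exact h1.ne h2
  edge_disjoint := by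
    rintro e u e' u' he he' ⟨x, hx, hx'⟩
    have R' := deform_isReversible h hη hδ hs
    obtain ⟨v, hu, rfl⟩ := R'.isOpenEdge_iff.1 he
    obtain ⟨v', hu', rfl⟩ := R'.isOpenEdge_iff.1 he'
    obtain ⟨z, a, a', hz, hz'⟩ := exists_common_base_of_deform h hη hδ hs hu hu'
      (openEdge_subset _ _ hx) (openEdge_subset _ _ hx')
    rw [← R'.openEdge_eq (deform_sameEdge h hη hδ hs hz)] at hx ⊢
    rw [← R'.openEdge_eq (deform_sameEdge h hη hδ hs hz')] at hx' ⊢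
    obtain ⟨t, ht, rfl⟩ := hx
    obtain ⟨t', ht', hxt⟩ := hx'
    have := eq_of_smul_latticeVec_eq (h.primitive _ _ (h.isReversible.mem_star hz hu))
      (h.primitive _ _ (h.isReversible.mem_star hz' hu')) ht.1 ht'.1 (add_left_cancel hxt)
    rw [this]
  balanced := h.balanced

/-- Dual placements depend only on the stars and on the relation `HeadsTo`, not on the positions of
the vertices. -/
theorem deform_sameSubdividedDualPolygon : Γ.SameSubdividedDualPolygon (Γ.deform δ) := by
  have key : ∀ P : Fin Γ.n → Set Plane, Γ.IsDualPlacement P ↔ (Γ.deform δ).IsDualPlacement P :=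
    fun P => and_congr Iff.rfl (forall_congr' fun v => forall_congr' fun u => forall_congr' fun w =>
      imp_congr (deform_headsTo_iff h hη hδ hs).symm Iff.rfl)
  ext S
  exact exists_congr fun P => and_congr (key P) Iff.rfl

end Deform

theorem SameSubdividedDualPolygon.sameDualPolygon {Γ' : PlaneGraph}
    (h : Γ.SameSubdividedDualPolygon Γ') : Γ.SameDualPolygon Γ' := by
  unfold SameDualPolygon dualPolygons
  rw [h]

/-! ### Tripods and their position relative to `c` -/

/-- A labelling `I, J, K` of the three directions at each vertex of a smooth curve, such that `c`
is in the cone spanned by `I` and `J`, closer to `J`. -/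
structure TripodLabelling (Γ : PlaneGraph) (c : Plane) where
  I : Fin Γ.n → ℤ × ℤ
  J : Fin Γ.n → ℤ × ℤ
  K : Fin Γ.n → ℤ × ℤ
  star_eq : ∀ v, Γ.star v = {I v, J v, K v}
  K_eq : ∀ v, K v = -(I v + J v)
  det_eq : ∀ v, |latticeDet (I v) (J v)| = 1
  cone : ∀ v, ∃ a b : ℝ, 0 < a ∧ a < b ∧ c = a • latticeVec (I v) + b • latticeVec (J v)

/-- Cramer's rule with determinant `ε = ±1`. -/
theorem exists_cone_coordinates {x y : ℤ × ℤ} {c : Plane} {ε : ℝ} (hε : ε * ε = 1)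
    (hdet : cross (latticeVec x) (latticeVec y) = ε)
    (hy : ε * cross (latticeVec y) c < 0)
    (hxy : 0 < ε * (cross (latticeVec x) c + cross (latticeVec y) c)) :
    ∃ a b : ℝ, 0 < a ∧ a < b ∧ c = a • latticeVec x + b • latticeVec y := by
  refine ⟨-(ε * cross (latticeVec y) c), ε * cross (latticeVec x) c, by linarith, by linarith, ?_⟩
  subst hdet
  simp only [cross] at hε ⊢
  ext
  · simp only [Prod.fst_add, Prod.smul_fst, smul_eq_mul]
    linear_combination (-c.1) * hε
  · simp only [Prod.snd_add, Prod.smul_snd, smul_eq_mul]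
    linear_combination (-c.2) * hε

/-- The six rays spanned by `±x, ±y, ±z` cut the plane into six open sectors, and `c` lies in one of
them. In terms of signs: the three determinants with `c` are nonzero and sum to zero, so one sign
differs from the other two. The direction with that sign is `i`, and the sign decides between the
two orders of the others. -/
theorem exists_tripod_label {s : Finset (ℤ × ℤ)} {c : Plane} (hcard : s.card = 3)
    (hdet : ∀ u ∈ s, ∀ u' ∈ s, u ≠ u' → |latticeDet u u'| = 1) (hsum : ∑ u ∈ s, u = 0)
    (hc : ∀ u ∈ s, cross (latticeVec u) c ≠ 0) :
    ∃ i j k : ℤ × ℤ, s = {i, j, k} ∧ k = -(i + j) ∧ |latticeDet i j| = 1 ∧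
      ∃ a b : ℝ, 0 < a ∧ a < b ∧ c = a • latticeVec i + b • latticeVec j := by
  obtain ⟨x, y, z, hxy, hxz, hyz, rfl⟩ := Finset.card_eq_three.1 hcard
  rw [Finset.sum_insert (by simp [hxy, hxz]), Finset.sum_insert (by simp [hyz]),
    Finset.sum_singleton] at hsum
  have mx : x ∈ ({x, y, z} : Finset (ℤ × ℤ)) := by simp
  have my : y ∈ ({x, y, z} : Finset (ℤ × ℤ)) := by simp
  have mz : z ∈ ({x, y, z} : Finset (ℤ × ℤ)) := by simp
  have hz : z = -(x + y) := by
    rw [← add_assoc] at hsum; exact eq_neg_of_add_eq_zero_right hsum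
  have hlz : latticeVec z = -(latticeVec x + latticeVec y) := by
    rw [hz, latticeVec_neg, latticeVec_add]
  obtain ⟨ε, hε⟩ : ∃ ε, ε = cross (latticeVec x) (latticeVec y) := ⟨_, rfl⟩
  have hε2 : ε * ε = 1 := by
    have h1 := hdet x mx y my hxy
    rw [hε, cross_latticeVec, ← abs_mul_abs_self, ← Int.cast_abs, h1]; norm_num
  have dyz : cross (latticeVec y) (latticeVec z) = ε := by
    rw [hlz, hε]; simp [cross]; ring
  have dzx : cross (latticeVec z) (latticeVec x) = ε := by
    rw [hlz, hε]; simp [cross]; ring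
  have dzy : cross (latticeVec z) (latticeVec y) = -ε := by rw [cross_comm, dyz]
  have dxz : cross (latticeVec x) (latticeVec z) = -ε := by rw [cross_comm, dzx]
  have dyx : cross (latticeVec y) (latticeVec x) = -ε := by rw [cross_comm, hε]
  have hε2' : -ε * -ε = 1 := by rw [neg_mul_neg, hε2]
  have hs : cross (latticeVec x) c + cross (latticeVec y) c + cross (latticeVec z) c = 0 := by
    rw [hlz, cross_neg_left, cross_add_left]; ring
  have hε0 : ε ≠ 0 := by rintro rfl; simp at hε2
  have ex : ε * cross (latticeVec x) c ≠ 0 := mul_ne_zero hε0 (hc x mx)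
  have ey : ε * cross (latticeVec y) c ≠ 0 := mul_ne_zero hε0 (hc y my)
  have ez : ε * cross (latticeVec z) c ≠ 0 := mul_ne_zero hε0 (hc z mz)
  have es : ε * cross (latticeVec x) c + ε * cross (latticeVec y) c +
      ε * cross (latticeVec z) c = 0 := by rw [← mul_add, ← mul_add, hs, mul_zero]
  rcases ex.lt_or_gt with hx | hx <;> rcases ey.lt_or_gt with hy | hy <;>
    rcases ez.lt_or_gt with hz' | hz'
  · linarith
  · exact ⟨z, x, y, by grind, by rw [hz]; abel, hdet _ mz _ mx hxz.symm,
      exists_cone_coordinates hε2 dzx (by linarith) (by linarith)⟩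
  · exact ⟨y, z, x, by grind, by rw [hz]; abel, hdet _ my _ mz hyz,
      exists_cone_coordinates hε2 dyz (by linarith) (by linarith)⟩
  · exact ⟨x, z, y, by grind, by rw [hz]; abel, hdet _ mx _ mz hxz,
      exists_cone_coordinates hε2' dxz (by linarith) (by linarith)⟩
  · exact ⟨x, y, z, by grind, by rw [hz], hdet _ mx _ my hxy,
      exists_cone_coordinates hε2 hε.symm (by linarith) (by linarith)⟩
  · exact ⟨y, x, z, by grind, by rw [hz]; abel, hdet _ my _ mx hxy.symm,
      exists_cone_coordinates hε2' dyx (by linarith) (by linarith)⟩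
  · exact ⟨z, y, x, by grind, by rw [hz]; abel, hdet _ mz _ my hyz.symm,
      exists_cone_coordinates hε2' dzy (by linarith) (by linarith)⟩
  · linarith

theorem IsSmooth.nonempty_tripodLabelling (hsmooth : Γ.IsSmooth) (h : Γ.IsTropicalCurve)
    {c : Plane} (hc : ∀ v, ∀ u ∈ Γ.star v, cross (latticeVec u) c ≠ 0) :
    Nonempty (Γ.TripodLabelling c) := by
  have key := fun v => exists_tripod_label (hsmooth v).1 (hsmooth v).2 (h.balanced v) (hc v)
  choose I J K h1 h2 h3 h4 using key
  exact ⟨⟨I, J, K, h1, h2, h3, h4⟩⟩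

namespace TripodLabelling

variable {c : Plane} (L : Γ.TripodLabelling c)

theorem latticeVec_K (v : Fin Γ.n) :
    latticeVec (L.K v) = -(latticeVec (L.I v) + latticeVec (L.J v)) := by
  rw [L.K_eq, latticeVec_neg, latticeVec_add]

theorem I_mem (v : Fin Γ.n) : L.I v ∈ Γ.star v := by simp [L.star_eq]
theorem J_mem (v : Fin Γ.n) : L.J v ∈ Γ.star v := by simp [L.star_eq]
theorem K_mem (v : Fin Γ.n) : L.K v ∈ Γ.star v := by simp [L.star_eq]

/-- The determinant `±1` of `I v` and `J v`. -/
def sign (v : Fin Γ.n) : ℝ := cross (latticeVec (L.I v)) (latticeVec (L.J v))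

theorem sign_mul_self (v : Fin Γ.n) : L.sign v * L.sign v = 1 := by
  rw [sign, cross_latticeVec, ← abs_mul_abs_self, ← Int.cast_abs, L.det_eq]; norm_num

theorem sign_ne_zero (v : Fin Γ.n) : L.sign v ≠ 0 := by
  intro h
  have := L.sign_mul_self v
  simp [h] at this

theorem cross_I_K (v : Fin Γ.n) :
    cross (latticeVec (L.I v)) (latticeVec (L.K v)) = -L.sign v := by
  rw [L.latticeVec_K, cross_neg_right, cross_add_right, cross_same, zero_add, sign]

theorem cross_J_K (v : Fin Γ.n) :
    cross (latticeVec (L.J v)) (latticeVec (L.K v)) = L.sign v := by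
  rw [L.latticeVec_K, cross_neg_right, cross_add_right, cross_same, add_zero, cross_comm, neg_neg,
    sign]

/-- The two arms leave the vertex on opposite sides of the line in direction `c`, so a strand passes
through each of its vertices transversally to `c`. -/
theorem cross_I_mul_cross_J (v : Fin Γ.n) :
    cross c (latticeVec (L.I v)) * cross c (latticeVec (L.J v)) < 0 := by
  obtain ⟨a, b, ha, hab, hc⟩ := L.cone v
  have h1 : cross c (latticeVec (L.I v)) = -(b * L.sign v) := by
    have := congrArg (fun y => cross y (latticeVec (L.I v))) hc
    simp only [cross_add_left, cross_smul_left, cross_same] at this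
    rw [this, sign, cross_comm (latticeVec (L.J v))]; ring
  have h2 : cross c (latticeVec (L.J v)) = a * L.sign v := by
    have := congrArg (fun y => cross y (latticeVec (L.J v))) hc
    simp only [cross_add_left, cross_smul_left, cross_same] at this
    rw [this, sign]; ring
  have h3 := L.sign_mul_self v
  rw [h1, h2]
  have : -(b * L.sign v) * (a * L.sign v) = -(a * b) * (L.sign v * L.sign v) := by ring
  rw [this, h3]
  have := mul_pos ha (ha.trans hab)
  linarith

/-- The directions `I v` and `J v`. -/
def IsArm (v : Fin Γ.n) (u : ℤ × ℤ) : Prop := u = L.I v ∨ u = L.J v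

variable {L}

theorem IsArm.mem {v : Fin Γ.n} {u : ℤ × ℤ} (h : L.IsArm v u) : u ∈ Γ.star v := by
  rcases h with rfl | rfl
  exacts [L.I_mem v, L.J_mem v]

theorem IsArm.cross_ne_zero {v : Fin Γ.n} {u : ℤ × ℤ} (h : L.IsArm v u) :
    cross c (latticeVec u) ≠ 0 := by
  have := L.cross_I_mul_cross_J v
  rcases h with rfl | rfl
  · exact left_ne_zero_of_mul this.ne
  · exact right_ne_zero_of_mul this.ne

variable (L)

theorem isArm_or_eq {v : Fin Γ.n} {u : ℤ × ℤ} (hu : u ∈ Γ.star v) : L.IsArm v u ∨ u = L.K v := by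
  rw [L.star_eq] at hu
  simp only [Finset.mem_insert, Finset.mem_singleton] at hu
  rcases hu with h | h | h
  exacts [Or.inl (Or.inl h), Or.inl (Or.inr h), Or.inr h]

/-! ### Strands and the region below them -/

/-- A set of vertices that is closed under following the arms in both directions. -/
def IsStrand (A : Set (Fin Γ.n)) : Prop :=
  ∀ v ∈ A, ∀ u, L.IsArm v u → ∀ w, Γ.HeadsTo v u w → w ∈ A ∧ L.IsArm w (-u)

/-- The union of the arms at the vertices in `A`. -/
def curve (A : Set (Fin Γ.n)) : Set Plane :=
  {x | ∃ v ∈ A, ∃ u, L.IsArm v u ∧ x ∈ Γ.closedEdge v u}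

/-- The points from which one meets the curve of `A` when moving in direction `c`. -/
def below (A : Set (Fin Γ.n)) : Set Plane :=
  {x | ∃ τ : ℝ, 0 ≤ τ ∧ x + τ • c ∈ L.curve A}

variable {L}

theorem curve_subset_below (A : Set (Fin Γ.n)) : L.curve A ⊆ L.below A :=
  fun _ hx => ⟨0, le_rfl, by simpa using hx⟩

theorem curve_mono {A B : Set (Fin Γ.n)} (h : A ⊆ B) : L.curve A ⊆ L.curve B :=
  fun _ ⟨v, hv, u, hu, hx⟩ => ⟨v, h hv, u, hu, hx⟩

theorem pos_mem_curve (h : Γ.IsTropicalCurve) {A : Set (Fin Γ.n)} {v : Fin Γ.n} (hv : v ∈ A) :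
    Γ.pos v ∈ L.curve A :=
  ⟨v, hv, L.I v, Or.inl rfl, h.isReversible.pos_mem_closedEdge (L.I_mem v)⟩

/-- The points below a single arm, in coordinates. -/
theorem exists_add_smul_mem_closedEdge_iff {v : Fin Γ.n} {u : ℤ × ℤ} (hu : L.IsArm v u)
    (x : Plane) :
    (∃ τ : ℝ, 0 ≤ τ ∧ x + τ • c ∈ Γ.closedEdge v u) ↔
      cross c (x - Γ.pos v) / cross c (latticeVec u) ∈ Γ.reach v u ∧
        0 ≤ cross (latticeVec u) (x - Γ.pos v) / cross c (latticeVec u) := by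
  have hc := hu.cross_ne_zero
  constructor
  · rintro ⟨τ, hτ, t, ht, hx⟩
    have hx' : x - Γ.pos v = t • latticeVec u - τ • c := by
      rw [sub_eq_sub_iff_add_eq_add, hx]; abel
    rw [hx']
    simp only [cross_sub_right, cross_smul_right, cross_same, cross_comm (latticeVec u) c]
    constructor
    · convert ht using 1
      field_simp; ring
    · convert hτ using 1
      field_simp; ring
  · rintro ⟨h1, h2⟩
    refine ⟨_, h2, _, h1, ?_⟩
    have := eq_cross_smul_sub hc (x - Γ.pos v)
    rw [sub_eq_iff_eq_add] at this
    nth_rewrite 1 [this]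
    abel

theorem isClosed_below (A : Set (Fin Γ.n)) : IsClosed (L.below A) := by
  have : L.below A = ⋃ v : Fin Γ.n, ⋃ u ∈ Γ.star v,
      {x | (v ∈ A ∧ L.IsArm v u) ∧ ∃ τ : ℝ, 0 ≤ τ ∧ x + τ • c ∈ Γ.closedEdge v u} := by
    ext x
    simp only [Set.mem_iUnion, Set.mem_ofPred_eq, exists_prop]
    constructor
    · rintro ⟨τ, hτ, v, hv, u, hu, hx⟩
      exact ⟨v, u, hu.mem, ⟨hv, hu⟩, τ, hτ, hx⟩
    · rintro ⟨v, u, -, ⟨hv, hu⟩, τ, hτ, hx⟩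
      exact ⟨τ, hτ, v, hv, u, hu, hx⟩
  rw [this]
  refine isClosed_iUnion_of_finite fun v => isClosed_biUnion_finset fun u _ => ?_
  by_cases hvu : v ∈ A ∧ L.IsArm v u
  · simp only [hvu, true_and, exists_add_smul_mem_closedEdge_iff hvu.2, and_self]
    have cont : ∀ p q r, Continuous fun y : Plane => cross p (y - q) / r := fun p q r =>
      ((continuous_cross p).comp (continuous_id.sub continuous_const)).div_const r
    exact IsClosed.inter ((isClosed_reach v u).preimage (cont c (Γ.pos v) _))
      (isClosed_Ici.preimage (cont (latticeVec u) (Γ.pos v) _))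
  · simp [hvu]

/-- The points below an interior point of an arm have a neighbourhood of such points, and so do the
points below a vertex, which has arms on both sides. -/
theorem below_mem_nhds (h : Γ.IsTropicalCurve) {A : Set (Fin Γ.n)} (hA : L.IsStrand A) {x : Plane}
    (hx : x ∈ L.below A) (hxA : x ∉ L.curve A) : L.below A ∈ 𝓝 x := by
  have R := h.isReversible
  obtain ⟨τ, hτ, v, hv, u, hu, hxu⟩ := hx
  have hτ0 : 0 < τ := hτ.lt_of_ne fun h0 => hxA ⟨v, hv, u, hu, by simpa [← h0] using hxu⟩
  have cont : ∀ (p q : Plane) (r : ℝ), Continuous fun y : Plane => cross p (y - q) / r := fun p q r =>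
    ((continuous_cross p).comp (continuous_id.sub continuous_const)).div_const _
  have vertex_case : ∀ z ∈ A, x + τ • c = Γ.pos z → L.below A ∈ 𝓝 x := by
    intro z hz hxz
    have hxz' : x - Γ.pos z = -(τ • c) := by rw [← hxz]; abel
    have arm : ∀ u, L.IsArm z u → ∀ᶠ y in 𝓝 x,
        0 ≤ cross c (y - Γ.pos z) / cross c (latticeVec u) → y ∈ L.below A := by
      intro u hu
      have hcu := hu.cross_ne_zero
      obtain ⟨r, hr, hreach⟩ := R.eventually_mem_openReach hu.mem
      have e1 : ∀ᶠ y in 𝓝 x, cross c (y - Γ.pos z) / cross c (latticeVec u) < r := by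
        refine (cont _ _ _).tendsto x |>.eventually_lt_const ?_
        rw [hxz', cross_neg_right, cross_smul_right, cross_same]; simpa using hr
      have e2 : ∀ᶠ y in 𝓝 x, 0 < cross (latticeVec u) (y - Γ.pos z) / cross c (latticeVec u) := by
        refine (cont _ _ _).tendsto x |>.eventually_const_lt ?_
        rwa [hxz', cross_neg_right, cross_smul_right, cross_comm (latticeVec u), mul_neg, neg_neg,
          mul_div_cancel_right₀ _ hcu]
      filter_upwards [e1, e2] with y h1 h2 h0
      obtain ⟨τ', hτ', hy⟩ := (exists_add_smul_mem_closedEdge_iff hu y).2 ⟨by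
        rcases h0.eq_or_lt with h0 | h0
        · rw [← h0]; exact R.zero_mem_reach hu.mem
        · have := hreach _ h0 h1
          exact ⟨this.1.le, fun w s hw hs => (this.2 w s hw hs).le⟩, h2.le⟩
      exact ⟨τ', hτ', z, hz, u, hu, hy⟩
    -- If a nearby point were on the wrong side for both arms, its two quotients would be negative;
    -- their product is a square over a negative number, a contradiction.
    filter_upwards [arm _ (Or.inl rfl), arm _ (Or.inr rfl)] with y h1 h2
    by_contra hy
    have h1' := lt_of_not_ge fun hh => hy (h1 hh)
    have h2' := lt_of_not_ge fun hh => hy (h2 hh)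
    have h3 := mul_pos_of_neg_of_neg h1' h2'
    rw [div_mul_div_comm] at h3
    have h4 := div_nonpos_of_nonneg_of_nonpos (mul_self_nonneg (cross c (y - Γ.pos z)))
      (L.cross_I_mul_cross_J z).le
    linarith
  rcases mem_closedEdge_cases hxu with hopen | hend | ⟨w, hw, hend⟩
  · obtain ⟨t, ht, hxt⟩ := hopen
    have hcu := hu.cross_ne_zero
    have hx' : x - Γ.pos v = t • latticeVec u - τ • c := by
      rw [sub_eq_sub_iff_add_eq_add, hxt]; abel
    have h1 : cross c (x - Γ.pos v) / cross c (latticeVec u) = t := by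
      rw [hx', cross_sub_right, cross_smul_right, cross_smul_right, cross_same]; field_simp; ring
    have e1 : ∀ᶠ y in 𝓝 x, 0 < cross c (y - Γ.pos v) / cross c (latticeVec u) := by
      refine (cont _ _ _).tendsto x |>.eventually_const_lt ?_
      rw [h1]; exact ht.1
    have e2 : ∀ᶠ y in 𝓝 x, 0 < cross (latticeVec u) (y - Γ.pos v) / cross c (latticeVec u) := by
      refine (cont _ _ _).tendsto x |>.eventually_const_lt ?_
      rwa [hx', cross_sub_right, cross_smul_right, cross_smul_right, cross_same,
        cross_comm (latticeVec u), mul_zero, zero_sub, mul_neg, neg_neg, mul_div_cancel_right₀ _ hcu]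
    have e3 : ∀ᶠ y in 𝓝 x, cross c (y - Γ.pos v) / cross c (latticeVec u) ∈ Γ.reach v u := by
      rcases heads_or_ray hu.mem with ⟨w, s, hs, hw, hws⟩ | hray
      · rw [R.reach_eq hw hws]
        have : ∀ᶠ y in 𝓝 x, cross c (y - Γ.pos v) / cross c (latticeVec u) < s := by
          refine (cont _ _ _).tendsto x |>.eventually_lt_const ?_
          rw [h1]; exact ht.2 w s hw hws
        filter_upwards [e1, this] with y h1 h2 using ⟨h1.le, h2.le⟩
      · rw [hray.reach_eq]
        filter_upwards [e1] with y h1 using h1.le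
    filter_upwards [e2, e3] with y h2 h3
    obtain ⟨τ', hτ', hy⟩ := (exists_add_smul_mem_closedEdge_iff hu y).2 ⟨h3, h2.le⟩
    exact ⟨τ', hτ', v, hv, u, hu, hy⟩
  · exact vertex_case v hv hend
  · exact vertex_case w (hA v hv u hu w hw).1 hend

/-- Away from the curve of a strand, being below it is constant on connected sets. -/
theorem subset_below (h : Γ.IsTropicalCurve) {A : Set (Fin Γ.n)} (hA : L.IsStrand A)
    {s : Set Plane} (hs : IsPreconnected s) (hsA : Disjoint s (L.curve A)) {x : Plane} (hx : x ∈ s)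
    (hxA : x ∈ L.below A) : s ⊆ L.below A := by
  -- Off the curve the region below is open, and it is closed in the plane; hence its trace on `s`
  -- is both open and closed in `s`.
  have hopen : s ∩ L.below A = s ∩ interior (L.below A) := by
    ext y
    refine ⟨fun hy => ⟨hy.1, mem_interior_iff_mem_nhds.2
      (below_mem_nhds h hA hy.2 (Set.disjoint_left.1 hsA hy.1))⟩,
      fun hy => ⟨hy.1, interior_subset hy.2⟩⟩
  have hcov : s ⊆ interior (L.below A) ∪ (L.below A)ᶜ := by
    intro y hy
    by_cases hyA : y ∈ L.below A
    · have : y ∈ s ∩ interior (L.below A) := hopen ▸ ⟨hy, hyA⟩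
      exact Or.inl this.2
    · exact Or.inr hyA
  have := hs.subset_left_of_subset_union isOpen_interior (isClosed_below A).isOpen_compl
    (Set.disjoint_left.2 fun y hy hy' => hy' (interior_subset hy)) hcov
    ⟨x, (hopen ▸ ⟨hx, hxA⟩ : x ∈ s ∩ interior (L.below A))⟩
  exact this.trans interior_subset

/-- An edge that is not an arm of the strand meets it at vertices only. -/
theorem eq_pos_of_mem_curve (h : Γ.IsTropicalCurve) {A : Set (Fin Γ.n)} (hA : L.IsStrand A)
    {v : Fin Γ.n} {u : ℤ × ℤ} (hu : u ∈ Γ.star v) (hvu : ¬ (v ∈ A ∧ L.IsArm v u)) {x : Plane}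
    (hx : x ∈ Γ.closedEdge v u) (hxA : x ∈ L.curve A) :
    ∃ z ∈ A, x = Γ.pos z ∧ (z = v ∨ Γ.HeadsTo v u z) := by
  have R := h.isReversible
  obtain ⟨v', hv', u', hu', hx'⟩ := hxA
  obtain ⟨z, a, a', hz, hz'⟩ := h.exists_common_base hu hu'.mem hx hx'
  have hzA : z ∈ A ∧ L.IsArm z a' := by
    rcases hz' with ⟨rfl, rfl⟩ | ⟨hw, rfl⟩
    · exact ⟨hv', hu'⟩
    · exact hA _ hv' _ hu' _ hw
  -- Otherwise both descriptions give the same edge, which would then be an arm of the strand seen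
  -- from `v`.
  have hne : a ≠ a' := by
    rintro rfl
    rcases hz with ⟨rfl, rfl⟩ | ⟨hw, rfl⟩
    · exact hvu hzA
    · have := hA z hzA.1 _ hzA.2 _ (h.heads_symm hw)
      rw [neg_neg] at this
      exact hvu this
  refine ⟨z, hzA.1, ?_, hz.imp And.left And.left⟩
  rw [← R.closedEdge_eq hz] at hx
  rw [← R.closedEdge_eq hz'] at hx'
  exact R.eq_pos_of_mem_closedEdge (R.mem_star hz hu) (R.mem_star hz' hu'.mem) hne hx hx'

theorem isPreconnected_closedEdge (v : Fin Γ.n) (u : ℤ × ℤ) :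
    IsPreconnected (Γ.closedEdge v u) := by
  have : Γ.closedEdge v u = (fun t : ℝ => Γ.pos v + t • latticeVec u) '' Γ.reach v u := by
    ext x; simp only [closedEdge, Set.mem_image, Set.mem_ofPred_eq, eq_comm]
  rw [this]
  exact (ordConnected_reach v u).isPreconnected.image _ (by fun_prop)

/-- The third edge at a vertex of a strand starts below the strand. -/
theorem exists_below_of_eq_K (h : Γ.IsTropicalCurve) {A : Set (Fin Γ.n)} {v : Fin Γ.n}
    (hv : v ∈ A) {r : ℝ} (hr : 0 < r) :
    ∃ t : ℝ, 0 < t ∧ t < r ∧ Γ.pos v + t • latticeVec (L.K v) ∈ L.below A := by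
  have R := h.isReversible
  obtain ⟨a, b, ha, hab, hc⟩ := L.cone v
  have hb := ha.trans hab
  obtain ⟨r', hr', hreach⟩ := R.eventually_mem_openReach (L.J_mem v)
  have hba : 0 < b / a := div_pos hb ha
  -- Since `tK + (t/a)c = (t b/a - t)J`, moving by `t/a` in direction `c` leads to the `J`-arm. The
  -- second bound on `t` keeps the parameter `t b/a - t` inside that edge, and `a < b` makes it
  -- positive.
  refine ⟨min (r / 2) (r' / (b / a) / 2), by positivity,
    (min_le_left _ _).trans_lt (by linarith), ?_⟩
  obtain ⟨t, ht⟩ : ∃ t, t = min (r / 2) (r' / (b / a) / 2) := ⟨_, rfl⟩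
  have ht0 : 0 < t := by rw [ht]; positivity
  have ht1 : t * (b / a) < r' := by
    have h1 : t ≤ r' / (b / a) / 2 := ht ▸ min_le_right _ _
    have h2 : t < r' / (b / a) := h1.trans_lt (half_lt_self (by positivity))
    rwa [lt_div_iff₀ hba] at h2
  rw [← ht]
  have hs : 0 < t * (b / a) - t := by
    have : 1 < b / a := (one_lt_div ha).2 hab
    nlinarith
  have hmem := hreach (t * (b / a) - t) hs (by linarith)
  refine ⟨t / a, by positivity, v, hv, L.J v, Or.inr rfl, t * (b / a) - t,
    ⟨hmem.1.le, fun w s hw hws => (hmem.2 w s hw hws).le⟩, ?_⟩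
  have hc' : (t / a) • c = t • latticeVec (L.I v) + (t * (b / a)) • latticeVec (L.J v) := by
    have := congrArg (fun y => (t / a) • y) hc
    simp only [smul_add, smul_smul] at this
    rw [this, div_mul_cancel₀ _ ha.ne', show t / a * b = t * (b / a) by ring]
  rw [L.latticeVec_K, hc', sub_smul, smul_neg, smul_add]
  abel

/-- Being below a strand propagates along the edges of the graph. -/
theorem below_of_adj (h : Γ.IsTropicalCurve) {A : Set (Fin Γ.n)} (hA : L.IsStrand A)
    {v w : Fin Γ.n} (hvw : Γ.graph.Adj v w) (hv : Γ.pos v ∈ L.below A) : Γ.pos w ∈ L.below A := by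
  have R := h.isReversible
  obtain ⟨u, hw⟩ := h.adj_heads v w hvw
  by_cases hwA : w ∈ A
  · exact curve_subset_below A (pos_mem_curve h hwA)
  by_cases hvA : v ∈ A
  · rcases L.isArm_or_eq hw.1 with hu | rfl
    · exact absurd (hA v hvA u hu w hw).1 hwA
    · obtain ⟨s, hs, hws⟩ := id hw.2.2
      obtain ⟨t, ht, hts, hbelow⟩ := exists_below_of_eq_K (L := L) h hvA hs
      have hnot : ¬ (v ∈ A ∧ L.IsArm v (L.K v)) := by
        rintro ⟨-, hK | hK⟩
        · have := L.cross_I_K v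
          rw [hK, cross_same] at this
          exact L.sign_ne_zero v (by linarith)
        · have := L.cross_J_K v
          rw [hK, cross_same] at this
          exact L.sign_ne_zero v this.symm
      -- The interval is open at `0` because the edge starts at `v`, which lies on the curve itself.
      let S : Set Plane := (fun t : ℝ => Γ.pos v + t • latticeVec (L.K v)) '' Set.Ioc 0 s
      have hS : Disjoint S (L.curve A) := by
        rw [Set.disjoint_left]
        rintro _ ⟨r, ⟨hr0, hrs⟩, rfl⟩ hxA
        obtain ⟨z, hz, hxz, rfl | hz'⟩ := eq_pos_of_mem_curve h hA hw.1 hnot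
          ⟨r, by rw [R.reach_eq hw hws]; exact ⟨hr0.le, hrs⟩, rfl⟩ hxA
        · simp only [add_eq_left] at hxz
          exact smul_ne_zero hr0.ne' (R.ne_zero hw.1) hxz
        · exact hwA (h.heads_unique hz' hw ▸ hz)
      refine subset_below h hA (isPreconnected_Ioc.image _ (by fun_prop)) hS
        (⟨t, ⟨ht, hts.le⟩, rfl⟩ : _ ∈ S) hbelow ⟨s, ⟨hs, le_rfl⟩, hws.symm⟩
  · refine subset_below h hA (isPreconnected_closedEdge v u) ?_ (R.pos_mem_closedEdge hw.1) hv
      (R.pos_mem_closedEdge_of_heads hw)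
    rw [Set.disjoint_left]
    intro x hx hxA
    obtain ⟨z, hz, -, rfl | hz'⟩ := eq_pos_of_mem_curve h hA hw.1 (fun hh => hvA hh.1) hx hxA
    · exact hvA hz
    · exact hwA (h.heads_unique hz' hw ▸ hz)

theorem below_of_reachable (h : Γ.IsTropicalCurve) {A : Set (Fin Γ.n)} (hA : L.IsStrand A)
    {v w : Fin Γ.n} (hvw : Γ.graph.Reachable v w) (hv : Γ.pos v ∈ L.below A) :
    Γ.pos w ∈ L.below A := by
  obtain ⟨p⟩ := hvw
  induction p with
  | nil => exact hv
  | cons hadj _ ih => exact ih (below_of_adj h hA hadj hv)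

/-- Each vertical line meets an arm at most once. -/
theorem finite_vertical (x : Plane) (B : Set (Fin Γ.n)) :
    {τ : ℝ | x + τ • c ∈ L.curve B}.Finite := by
  have : {τ : ℝ | x + τ • c ∈ L.curve B} ⊆ ⋃ v : Fin Γ.n, ⋃ u ∈ Γ.star v,
      {τ : ℝ | L.IsArm v u ∧ x + τ • c ∈ Γ.closedEdge v u} := by
    rintro τ ⟨v, -, u, hu, hx⟩
    simp only [Set.mem_iUnion]
    exact ⟨v, u, hu.mem, hu, hx⟩
  refine Set.Finite.subset (Set.finite_iUnion fun v => (Γ.star v).finite_toSet.biUnion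
    fun u _ => Set.Subsingleton.finite ?_) this
  rintro τ ⟨hu, t, -, hx⟩ τ' ⟨-, t', -, hx'⟩
  have hcu := hu.cross_ne_zero
  have h1 := congrArg (cross (latticeVec u)) hx
  have h2 := congrArg (cross (latticeVec u)) hx'
  simp only [cross_add_right, cross_smul_right, cross_same] at h1 h2
  rw [cross_comm] at hcu
  have : (τ - τ') * cross (latticeVec u) c = 0 := by linarith
  rcases mul_eq_zero.1 this with h | h
  · linarith
  · exact absurd h (by simpa using hcu)

/-- A nonempty strand `B` contains a vertex that is contained in every nonempty connected
substrand. -/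
theorem exists_mem_substrand (h : Γ.IsTropicalCurve) {B : Set (Fin Γ.n)} (hB : L.IsStrand B)
    (hne : B.Nonempty) :
    ∃ v ∈ B, ∀ A ⊆ B, L.IsStrand A → (∃ w ∈ A, Γ.graph.Reachable w v) → v ∈ A := by
  have R := h.isReversible
  obtain ⟨v₀, hv₀⟩ := hne
  -- Take the last point of the curve of `B` on the line from `v₀` in direction `c`. It lies on an
  -- arm at some `v`, and this `v` is the required vertex.
  obtain ⟨τ, hτ, hmax⟩ := Set.exists_max_image _ id (finite_vertical (L := L) (Γ.pos v₀) B)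
    ⟨0, by simpa using pos_mem_curve h hv₀⟩
  obtain ⟨v, hv, u, hu, hx⟩ := id hτ.out
  refine ⟨v, hv, fun A hAB hA ⟨w, hw, hwv⟩ => ?_⟩
  by_contra hvA
  have hdis : Disjoint (Γ.closedEdge v u) (L.curve A) := by
    rw [Set.disjoint_left]
    intro y hy hyA
    obtain ⟨z, hz, -, rfl | hvz⟩ := eq_pos_of_mem_curve h hA hu.mem (fun hh => hvA hh.1) hy hyA
    · exact hvA hz
    · exact hvA (hA z hz _ (hB v hv u hu z hvz).2 _ (h.heads_symm hvz)).1
  -- If `v ∉ A`, the whole edge misses the curve of `A`. As `v` is connected to `A`, it is below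
  -- `A`, and so is the last point `x`. The curve of `A`, a part of that of `B`, would then pass at
  -- or beyond `x`.
  have hbelow := subset_below h hA (isPreconnected_closedEdge v u) hdis
    (R.pos_mem_closedEdge hu.mem)
    (below_of_reachable h hA hwv (curve_subset_below A (pos_mem_curve h hw))) hx
  obtain ⟨τ', hτ', hx'⟩ := hbelow
  have h1 : Γ.pos v₀ + (τ + τ') • c ∈ L.curve A := by rwa [add_smul, ← add_assoc]
  have h2 := hmax (τ + τ') (curve_mono hAB h1)
  simp only [id] at h2
  obtain rfl : τ' = 0 := by linarith
  rw [add_zero] at h1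
  exact Set.disjoint_left.1 hdis hx h1

end TripodLabelling

end PlaneGraph


/-! ### Intersecting the curve with its small deformations -/

theorem divisorOf_apply {k : ℕ} (x : Fin k → Plane) (p : Plane) :
    divisorOf x p = ∑ i, if x i = p then 1 else 0 := by
  simp [divisorOf, Finsupp.single_apply, Finsupp.finsetSum_apply]

theorem divisorOf_eq_zero {k : ℕ} {x : Fin k → Plane} {p : Plane} (h : ∀ i, x i ≠ p) :
    divisorOf x p = 0 := by
  simp [divisorOf_apply, h]

theorem divisorOf_apply_self {k : ℕ} {x : Fin k → Plane} (h : Function.Injective x) (i : Fin k) :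
    divisorOf x (x i) = 1 := by
  simp [divisorOf_apply, h.eq_iff]

namespace PlaneGraph

variable {Γ : PlaneGraph}

theorem IsReversible.mem_openReach_of_norm_lt (R : Γ.IsReversible) {v : Fin Γ.n} {u : ℤ × ℤ}
    {t : ℝ} (ht : 0 < t) (hn : ∀ w, Γ.graph.Adj v w → ‖t • latticeVec u‖ < ‖Γ.pos w - Γ.pos v‖) :
    t ∈ Γ.openReach v u := by
  refine ⟨ht, fun w s hw hs => ?_⟩
  obtain ⟨s', hs', hws'⟩ := id hw.2.2
  obtain rfl := R.heads_length hw hw hs hws'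
  have := hn w hw.2.1
  rw [hs, add_sub_cancel_left, norm_smul, norm_smul, Real.norm_of_nonneg ht.le,
    Real.norm_of_nonneg hs'.le] at this
  exact lt_of_mul_lt_mul_right this (norm_nonneg _)

theorem translate_zero : Γ.translate 0 = Γ := by
  simp [translate]

/-- A proper intersection needs no perturbation: the vector `0` and a constant family of points
serve as witnesses. -/
theorem IsProperIntersection.isStableIntersection {Γ' : PlaneGraph} {k : ℕ} {x : Fin k → Plane}
    (h : Γ.IsProperIntersection Γ' (divisorOf x)) : Γ.IsStableIntersection Γ' (divisorOf x) := by
  refine ⟨0, k, fun _ => x, x, Eventually.of_forall fun ε => ?_, tendsto_const_nhds, rfl⟩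
  rwa [smul_zero, translate_zero]

namespace TripodLabelling

variable {c : Plane} (L : Γ.TripodLabelling c)

/-- The `I`-coordinate of a vector in the basis `I v, J v`. -/
def coordI (v : Fin Γ.n) (x : Plane) : ℝ := -(L.sign v * cross (latticeVec (L.J v)) x)

/-- The excess of the `J`-coordinate over the `I`-coordinate of a vector. -/
def gap (v : Fin Γ.n) (x : Plane) : ℝ := -(L.sign v * cross (latticeVec (L.K v)) x)

/-- For `x = aI + bJ` this is the identity `(b - a)J = x + aK`. It exhibits the point where the
displaced `K`-ray meets the original `J`-ray. -/
theorem gap_smul_J (v : Fin Γ.n) (x : Plane) :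
    L.gap v x • latticeVec (L.J v) = x + L.coordI v x • latticeVec (L.K v) := by
  have h := L.sign_mul_self v
  have hK := L.latticeVec_K v
  simp only [gap, coordI, sign, hK] at h ⊢
  simp only [cross] at h ⊢
  ext
  · simp only [Prod.fst_add, Prod.snd_add, Prod.smul_fst, smul_eq_mul, Prod.fst_neg, Prod.snd_neg]
    linear_combination x.1 * h
  · simp only [Prod.fst_add, Prod.snd_add, Prod.smul_snd, smul_eq_mul, Prod.fst_neg, Prod.snd_neg]
    linear_combination x.2 * h

theorem sign_eq (v : Fin Γ.n) : L.sign v = 1 ∨ L.sign v = -1 :=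
  mul_self_eq_one_iff.1 (L.sign_mul_self v)

/-- Two tripods, one displaced by a vector of the open cone where `0 < I`-coordinate `<
J`-coordinate, meet in a single point. -/
theorem eq_gap_of_tripods_meet {z : Fin Γ.n} {a a' : ℤ × ℤ} (ha : a ∈ Γ.star z)
    (ha' : a' ∈ Γ.star z) {x : Plane} (hα : 0 < L.coordI z x) (hγ : 0 < L.gap z x) {t t' : ℝ}
    (ht : 0 ≤ t) (ht' : 0 ≤ t') (heq : t • latticeVec a = x + t' • latticeVec a') :
    a = L.J z ∧ t = L.gap z x := by
  have h1 := congrArg (cross (latticeVec (L.I z))) heq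
  have h2 := congrArg (cross (latticeVec (L.J z))) heq
  have hJI : cross (latticeVec (L.J z)) (latticeVec (L.I z)) = -L.sign z := by
    rw [cross_comm, sign]
  have hK : cross (latticeVec (L.K z)) x =
      -(cross (latticeVec (L.I z)) x + cross (latticeVec (L.J z)) x) := by
    rw [L.latticeVec_K, cross_neg_left, cross_add_left]
  have hIJ : cross (latticeVec (L.I z)) (latticeVec (L.J z)) = L.sign z := rfl
  rw [gap, hK] at hγ ⊢
  rw [coordI] at hα
  simp only [cross_add_right, cross_smul_right] at h1 h2
  have hIK := L.cross_I_K z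
  have hJK := L.cross_J_K z
  have hs := L.sign_eq z
  rw [L.star_eq] at ha ha'
  simp only [Finset.mem_insert, Finset.mem_singleton] at ha ha'
  -- Of the nine pairs of directions only `a = J`, `a' = K` is compatible with the two determinant
  -- equations and the sign conditions.
  generalize L.sign z = σ at *
  rcases ha with rfl | rfl | rfl <;> rcases ha' with rfl | rfl | rfl <;>
    simp only [cross_same, hJI, hIJ, hIK, hJK] at h1 h2 <;>
    rcases hs with rfl | rfl <;>
    first
    | exact ⟨rfl, by linarith⟩
    | (exfalso; linarith)

/-- The displacement of the intersection points when the vertices are displaced. -/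
def shift : (Fin Γ.n → Plane) →ₗ[ℝ] (Fin Γ.n → Plane) where
  toFun δ v := L.gap v (δ v) • latticeVec (L.J v)
  map_add' δ δ' := by
    ext1 v
    change _ = L.gap v (δ v) • latticeVec (L.J v) + L.gap v (δ' v) • latticeVec (L.J v)
    rw [← add_smul, Pi.add_apply, gap, cross_add_right, gap, gap]
    congr 1; ring
  map_smul' r δ := by
    ext1 v
    change _ = r • L.gap v (δ v) • latticeVec (L.J v)
    rw [Pi.smul_apply, smul_smul, gap, cross_smul_right, gap]
    congr 1; ring

/-- The displacements that are small and close to a multiple of `c`. -/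
def admissible (η : ℝ) : Set (Fin Γ.n → Plane) :=
  {δ | ∀ v, ‖δ v‖ < η ∧ 0 < L.coordI v (δ v) ∧ 0 < L.gap v (δ v) ∧
    ‖L.coordI v (δ v) • latticeVec (L.K v)‖ < η ∧ ‖L.gap v (δ v) • latticeVec (L.J v)‖ < η}

theorem continuous_coordI (v : Fin Γ.n) : Continuous (L.coordI v) := by
  unfold coordI; fun_prop

theorem continuous_gap (v : Fin Γ.n) : Continuous (L.gap v) := by
  unfold gap; fun_prop

theorem isOpen_admissible (η : ℝ) : IsOpen (L.admissible η) := by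
  have : L.admissible η = ⋂ v, (fun δ : Fin Γ.n → Plane => δ v) ⁻¹'
      {x | ‖x‖ < η ∧ 0 < L.coordI v x ∧ 0 < L.gap v x ∧
        ‖L.coordI v x • latticeVec (L.K v)‖ < η ∧ ‖L.gap v x • latticeVec (L.J v)‖ < η} := by
    ext δ; simp [admissible]
  rw [this]
  refine isOpen_iInter_of_finite fun v => IsOpen.preimage (continuous_apply v) ?_
  have h1 := L.continuous_coordI v
  have h2 := L.continuous_gap v
  exact (isOpen_lt continuous_norm continuous_const).inter <|
    (isOpen_lt continuous_const h1).inter <| (isOpen_lt continuous_const h2).inter <|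
    (isOpen_lt (h1.smul continuous_const).norm continuous_const).inter <|
    isOpen_lt (h2.smul continuous_const).norm continuous_const

theorem coordI_smul (v : Fin Γ.n) (s : ℝ) (x : Plane) :
    L.coordI v (s • x) = s * L.coordI v x := by
  rw [coordI, cross_smul_right, coordI]; ring

theorem gap_smul (v : Fin Γ.n) (s : ℝ) (x : Plane) : L.gap v (s • x) = s * L.gap v x := by
  rw [gap, cross_smul_right, gap]; ring

theorem coordI_pos (v : Fin Γ.n) : 0 < L.coordI v c := by
  obtain ⟨a, b, ha, hab, hc⟩ := L.cone v
  have := congrArg (cross (latticeVec (L.J v))) hc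
  rw [cross_add_right, cross_smul_right, cross_smul_right, cross_same,
    cross_comm (latticeVec (L.J v)) (latticeVec (L.I v)), ← sign] at this
  have h := L.sign_mul_self v
  rw [coordI, this]
  have : -(L.sign v * (a * -L.sign v + b * 0)) = a * (L.sign v * L.sign v) := by ring
  rw [this, h, mul_one]; exact ha

theorem gap_pos (v : Fin Γ.n) : 0 < L.gap v c := by
  obtain ⟨a, b, ha, hab, hc⟩ := L.cone v
  have := congrArg (cross (latticeVec (L.K v))) hc
  rw [cross_add_right, cross_smul_right, cross_smul_right,
    cross_comm (latticeVec (L.K v)) (latticeVec (L.I v)),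
    cross_comm (latticeVec (L.K v)) (latticeVec (L.J v)), L.cross_I_K, L.cross_J_K] at this
  have h := L.sign_mul_self v
  rw [gap, this]
  have : -(L.sign v * (a * - -L.sign v + b * -L.sign v)) = (b - a) * (L.sign v * L.sign v) := by
    ring
  rw [this, h, mul_one]; linarith

theorem exists_const_mem_admissible {η : ℝ} (hη : 0 < η) :
    ∃ s : ℝ, (fun _ => s • c) ∈ L.admissible η := by
  have hlim : ∀ f : ℝ → Plane, Continuous f → f 0 = 0 → ∀ᶠ s in 𝓝[>] (0 : ℝ), ‖f s‖ < η := by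
    intro f hf h0
    refine (hf.norm.tendsto 0).mono_left nhdsWithin_le_nhds |>.eventually_lt_const ?_
    simpa [h0] using hη
  have key : ∀ᶠ s in 𝓝[>] (0 : ℝ), (fun _ => s • c) ∈ L.admissible η := by
    change ∀ᶠ s in 𝓝[>] (0 : ℝ), ∀ v, _
    rw [eventually_all]
    intro v
    filter_upwards [eventually_mem_nhdsWithin, hlim (fun s => s • c) (by fun_prop) (by simp),
      hlim (fun s => (s * L.coordI v c) • latticeVec (L.K v)) (by fun_prop) (by simp),
      hlim (fun s => (s * L.gap v c) • latticeVec (L.J v)) (by fun_prop) (by simp)]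
      with s h0 h1 h2 h3
    rw [L.coordI_smul, L.gap_smul]
    exact ⟨h1, mul_pos h0 (L.coordI_pos v), mul_pos h0 (L.gap_pos v), h2, h3⟩
  exact key.exists

theorem shift_mem_openEdge (h : Γ.IsTropicalCurve) {η : ℝ} (hη : Γ.IsSmallScale η)
    {δ : Fin Γ.n → Plane} (hs : δ ∈ L.admissible η) (v : Fin Γ.n) :
    Γ.pos v + L.shift δ v ∈ Γ.openEdge v (L.J v) := by
  obtain ⟨h1, h2, h3, h4, h5⟩ := hs v
  refine ⟨L.gap v (δ v), h.isReversible.mem_openReach_of_norm_lt h3 fun w hw => ?_, rfl⟩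
  have := hη.vertex v w hw.ne
  linarith [hη.pos]

theorem shift_injective {η : ℝ} (hη : Γ.IsSmallScale η) {δ : Fin Γ.n → Plane}
    (hs : δ ∈ L.admissible η) : Function.Injective fun v => Γ.pos v + L.shift δ v := by
  intro v w hvw
  by_contra hne
  have h1 := hη.vertex v w hne
  have h2 : Γ.pos w - Γ.pos v = L.shift δ v - L.shift δ w := by
    rw [sub_eq_sub_iff_add_eq_add, add_comm (L.shift δ v)]; exact hvw.symm
  have h3 := norm_sub_le (L.shift δ v) (L.shift δ w)
  have h4 : ‖L.shift δ v‖ < η := (hs v).2.2.2.2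
  have h5 : ‖L.shift δ w‖ < η := (hs w).2.2.2.2
  rw [h2] at h1
  linarith [hη.pos]

section Intersection

variable (h : Γ.IsTropicalCurve) {η : ℝ} (hη : Γ.IsSmallScale η) {δ : Fin Γ.n → Plane}
  (hδ : δ ∈ Γ.slopeSpace) (hs : δ ∈ L.admissible η)
include h hη hδ hs

theorem shift_mem_deform_openEdge (v : Fin Γ.n) :
    Γ.pos v + L.shift δ v ∈ (Γ.deform δ).openEdge v (L.K v) := by
  obtain ⟨h1, h2, h3, h4, h5⟩ := hs v
  refine ⟨L.coordI v (δ v), (deform_isReversible h hη hδ fun v => (hs v).1).mem_openReach_of_norm_lt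
    h2 fun w hw => ?_, ?_⟩
  · have h6 := hη.vertex v w hw.ne
    have h7 : Γ.pos w - Γ.pos v = ((Γ.deform δ).pos w - (Γ.deform δ).pos v) - (δ w - δ v) := by
      change _ = (Γ.pos w + δ w - (Γ.pos v + δ v)) - _
      abel
    have h8 := norm_sub_le ((Γ.deform δ).pos w - (Γ.deform δ).pos v) (δ w - δ v)
    have h9 := norm_sub_le (δ w) (δ v)
    rw [← h7] at h8
    linarith [hη.pos, (hs w).1]
  · change Γ.pos v + L.gap v (δ v) • latticeVec (L.J v) = Γ.pos v + δ v + _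
    rw [L.gap_smul_J, add_assoc]

/-- A common point lies on an edge of `Γ` and within `η` of the original of a deformed edge. These
two edges share a vertex, so the computation for a pair of tripods applies. -/
theorem exists_eq_shift_of_mem_support {p : Plane} (hp : p ∈ Γ.support)
    (hp' : p ∈ (Γ.deform δ).support) : ∃ v, p = Γ.pos v + L.shift δ v := by
  have hs' := fun v => (hs v).1
  have R := h.isReversible
  have R' := deform_isReversible h hη hδ hs'
  obtain ⟨v, u, hu, hp⟩ := (R.mem_support_iff h.star_nonempty).1 hp
  obtain ⟨v', u', hu', hp'⟩ := (R'.mem_support_iff h.star_nonempty).1 hp'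
  obtain ⟨y, hy, hpy⟩ := exists_near_of_mem_deform h hη hδ hs' hu' hp'
  obtain ⟨z, a, a', hz, hz'⟩ := h.exists_common_base_of_near hη hu hu' hp hy
    (by linarith [hη.pos])
  rw [← R.closedEdge_eq hz] at hp
  rw [← R'.closedEdge_eq (deform_sameEdge h hη hδ hs' hz')] at hp'
  obtain ⟨t, ht, rfl⟩ := hp
  obtain ⟨t', ht', heq⟩ := hp'
  change _ = Γ.pos z + δ z + t' • latticeVec a' at heq
  rw [add_assoc, add_right_inj] at heq
  obtain ⟨rfl, rfl⟩ := L.eq_gap_of_tripods_meet (R.mem_star hz hu) (R.mem_star hz' hu')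
    (hs z).2.1 (hs z).2.2.1 ht.1 ht'.1 heq
  exact ⟨z, rfl⟩

theorem isProperIntersection_deform :
    Γ.IsProperIntersection (Γ.deform δ) (divisorOf fun v => Γ.pos v + L.shift δ v) := by
  have R := h.isReversible
  have R' := deform_isReversible h hη hδ fun v => (hs v).1
  have hopen : ∀ v, Γ.IsOpenEdge (Γ.openEdge v (L.J v)) (L.J v) := fun v =>
    R.isOpenEdge_iff.2 ⟨v, L.J_mem v, rfl⟩
  have hopen' : ∀ v : Fin Γ.n, (Γ.deform δ).IsOpenEdge ((Γ.deform δ).openEdge v (L.K v)) (L.K v) :=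
    fun v => R'.isOpenEdge_iff.2 ⟨v, L.K_mem v, rfl⟩
  have hmem := L.shift_mem_openEdge h hη hs
  have hmem' := L.shift_mem_deform_openEdge h hη hδ hs
  refine ⟨fun p hp => divisorOf_eq_zero ?_, ?_⟩
  · rintro v rfl
    exact hp ⟨Or.inr ⟨_, _, hopen v, hmem v⟩, Or.inr ⟨_, _, hopen' v, hmem' v⟩⟩
  · rintro p ⟨hp, hp'⟩
    obtain ⟨v, rfl⟩ := L.exists_eq_shift_of_mem_support h hη hδ hs hp hp'
    have hdet : |latticeDet (L.J v) (L.K v)| = 1 := by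
      rw [← L.det_eq v, L.K_eq]
      congr 1
      simp only [latticeDet, Prod.fst_neg, Prod.snd_neg, Prod.fst_add, Prod.snd_add]
      ring
    refine ⟨_, _, _, _, hopen v, hmem v, hopen' v, hmem' v, ?_, ?_⟩
    · intro h0
      rw [h0] at hdet
      simp at hdet
    · rw [hdet]
      exact divisorOf_apply_self (L.shift_injective hη hs) v

end Intersection

end TripodLabelling

end PlaneGraph


/-! ### Dimension count -/

theorem Submodule.exists_le_finrank_eq {V : Type*} [AddCommGroup V] [Module ℝ V]
    [FiniteDimensional ℝ V] (N : Submodule ℝ V) {m : ℕ} (hm : m ≤ Module.finrank ℝ N) :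
    ∃ M ≤ N, Module.finrank ℝ M = m := by
  obtain ⟨f, hf⟩ := exists_linearIndependent_of_le_finrank hm
  refine ⟨(Submodule.span ℝ (Set.range f)).map N.subtype, Submodule.map_subtype_le _ _, ?_⟩
  rw [Submodule.finrank_map_subtype_eq]
  simpa using finrank_span_eq_card hf

namespace PlaneGraph

variable {Γ : PlaneGraph}

/-- There are at most as many slope conditions as bounded edges. -/
theorem le_finrank_slopeSpace :
    2 * Γ.n ≤ Module.finrank ℝ Γ.slopeSpace + Nat.card Γ.graph.edgeSet := by
  classical
  let T : (Fin Γ.n → Plane) →ₗ[ℝ] (Γ.graph.edgeSet → ℝ) :=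
    LinearMap.pi fun e => (crossLin (Γ.pos (Quot.out e.1).2 - Γ.pos (Quot.out e.1).1)).comp
      (LinearMap.proj (R := ℝ) (φ := fun _ => Plane) (Quot.out e.1).2 -
        LinearMap.proj (R := ℝ) (φ := fun _ => Plane) (Quot.out e.1).1)
  have hT : LinearMap.ker T ≤ Γ.slopeSpace := by
    intro δ hδ v w hvw
    have h1 : cross (Γ.pos (Quot.out s(v, w)).2 - Γ.pos (Quot.out s(v, w)).1)
        (δ (Quot.out s(v, w)).2 - δ (Quot.out s(v, w)).1) = 0 :=
      congrFun (LinearMap.mem_ker.1 hδ) ⟨s(v, w), hvw⟩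
    have h2 : s((Quot.out s(v, w)).1, (Quot.out s(v, w)).2) = s(v, w) := Quot.out_eq s(v, w)
    -- The representative of an edge has an arbitrary orientation; reversing it changes the sign of
    -- both factors and leaves the condition unchanged.
    rcases Sym2.eq_iff.1 h2 with ⟨e1, e2⟩ | ⟨e1, e2⟩
    · rwa [e1, e2] at h1
    · rw [e1, e2, ← neg_sub (Γ.pos w), ← neg_sub (δ w), cross_neg_left, cross_neg_right,
        neg_neg] at h1
      exact h1
  have h1 := LinearMap.finrank_range_add_finrank_ker T
  have h2 : Module.finrank ℝ (LinearMap.range T) ≤ Nat.card Γ.graph.edgeSet := by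
    refine (Submodule.finrank_le _).trans ?_
    rw [Module.finrank_fintype_fun_eq_card, Nat.card_eq_fintype_card]
  have h3 := Submodule.finrank_mono hT
  have h4 : Module.finrank ℝ (Fin Γ.n → Plane) = 2 * Γ.n := by
    rw [Module.finrank_pi_fintype]
    simp [mul_comm]
  omega

theorem IsTropicalCurve.degree_le (h : Γ.IsTropicalCurve) [DecidableRel Γ.graph.Adj]
    (v : Fin Γ.n) : Γ.graph.degree v ≤ (Γ.star v).card := by
  have key : ∀ w : Fin Γ.n, ∃ u, Γ.graph.Adj v w → Γ.HeadsTo v u w := by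
    intro w
    by_cases hw : Γ.graph.Adj v w
    · obtain ⟨u, hu⟩ := h.adj_heads v w hw
      exact ⟨u, fun _ => hu⟩
    · exact ⟨0, fun hh => absurd hh hw⟩
  choose f hf using key
  rw [← Γ.graph.card_neighborFinset_eq_degree]
  refine Finset.card_le_card_of_injOn f ?_ ?_
  · intro w hw
    exact (hf w (by simpa using hw)).1
  · intro w hw w' hw' hww
    have h1 := hf w (by simpa using hw)
    have h2 := hf w' (by simpa using hw')
    rw [← hww] at h2
    exact h.heads_unique h1 h2

/-- This makes `d - g` nonnegative, so that it can be computed in `ℕ`. Since degrees are at most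
`3`, each component contributes at least `2` to the sum of `4 - deg`: either `4` from an isolated
vertex, or `1` from each of two adjacent vertices. -/
theorem IsTropicalCurve.card_edges_add_card_components_le (h : Γ.IsTropicalCurve)
    (hsmooth : Γ.IsSmooth) :
    Nat.card Γ.graph.edgeSet + Nat.card Γ.graph.ConnectedComponent ≤ 2 * Γ.n := by
  classical
  have hdeg : ∀ v, Γ.graph.degree v ≤ 3 := fun v => (hsmooth v).1 ▸ h.degree_le v
  have hsum := Γ.graph.sum_degrees_eq_twice_card_edges
  have h1 : ∑ v : Fin Γ.n, ((4 - Γ.graph.degree v) + Γ.graph.degree v) = 4 * Γ.n := by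
    rw [Finset.sum_congr rfl fun v _ => Nat.sub_add_cancel ((hdeg v).trans (by norm_num))]
    simp [mul_comm]
  rw [Finset.sum_add_distrib, hsum] at h1
  have h2 : 2 * Fintype.card Γ.graph.ConnectedComponent ≤ ∑ v, (4 - Γ.graph.degree v) := by
    rw [← Finset.sum_fiberwise Finset.univ Γ.graph.connectedComponentMk, mul_comm,
      ← smul_eq_mul, ← Finset.card_univ, ← Finset.sum_const]
    refine Finset.sum_le_sum fun C _ => ?_
    induction C using SimpleGraph.ConnectedComponent.ind with
    | _ v =>
      have hv : v ∈ Finset.univ.filter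
          (fun w => Γ.graph.connectedComponentMk w = Γ.graph.connectedComponentMk v) := by simp
      rcases Nat.eq_zero_or_pos (Γ.graph.degree v) with h0 | h0
      · have := Finset.single_le_sum (f := fun w => 4 - Γ.graph.degree w)
          (fun _ _ => Nat.zero_le _) hv
        simp only [h0] at this
        omega
      · obtain ⟨w, hw⟩ := (Γ.graph.degree_pos_iff_exists_adj v).1 h0
        have hsub : ({v, w} : Finset (Fin Γ.n)) ⊆ Finset.univ.filter
            (fun w => Γ.graph.connectedComponentMk w = Γ.graph.connectedComponentMk v) := by
          intro x hx
          rcases Finset.mem_insert.1 hx with rfl | hx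
          · exact hv
          · rw [Finset.mem_singleton.1 hx]
            simpa using hw.symm.reachable
        have := Finset.sum_le_sum_of_subset (f := fun w => 4 - Γ.graph.degree w) hsub
        rw [Finset.sum_pair hw.ne] at this
        have := hdeg v
        have := hdeg w
        omega
  rw [Nat.card_eq_fintype_card, Nat.card_eq_fintype_card, ← SimpleGraph.edgeFinset_card]
  omega

namespace TripodLabelling

variable {c : Plane} (L : Γ.TripodLabelling c)

theorem shift_eq_zero_iff (h : Γ.IsTropicalCurve) {δ : Fin Γ.n → Plane} :
    L.shift δ = 0 ↔ ∀ v, cross (latticeVec (L.K v)) (δ v) = 0 := by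
  rw [funext_iff]
  refine forall_congr' fun v => ?_
  change L.gap v (δ v) • latticeVec (L.J v) = 0 ↔ _
  simp [h.isReversible.ne_zero (L.J_mem v), gap, L.sign_ne_zero]

variable {L}

/-- A nonzero multiple of `K` is transverse to `I` and to `J`, so a vertex moving along its third
edge pushes both arms sideways. -/
theorem cross_ne_zero_of_isArm (h : Γ.IsTropicalCurve) {v : Fin Γ.n} {x : Plane}
    (hx : cross (latticeVec (L.K v)) x = 0) (hx0 : x ≠ 0) {u : ℤ × ℤ} (hu : L.IsArm v u) :
    cross (latticeVec u) x ≠ 0 := by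
  obtain ⟨s, rfl⟩ := exists_smul_of_cross_eq_zero (h.isReversible.ne_zero (L.K_mem v)) hx
  rw [cross_smul_right]
  refine mul_ne_zero (left_ne_zero_of_smul hx0) ?_
  rcases hu with rfl | rfl
  · rw [L.cross_I_K]; exact neg_ne_zero.2 (L.sign_ne_zero v)
  · rw [L.cross_J_K]; exact L.sign_ne_zero v

/-- The moving vertices of a displacement that fixes the intersection points form a strand. -/
theorem isStrand_of_shift_eq_zero (h : Γ.IsTropicalCurve) {δ : Fin Γ.n → Plane}
    (hδ : δ ∈ Γ.slopeSpace) (h0 : L.shift δ = 0) (C : Γ.graph.ConnectedComponent) :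
    L.IsStrand {v | Γ.graph.connectedComponentMk v = C ∧ δ v ≠ 0} := by
  have hK := (L.shift_eq_zero_iff h).1 h0
  rintro v ⟨hvC, hv⟩ u hu w hw
  have h1 : cross (latticeVec u) (δ w) ≠ 0 := by
    rw [cross_eq_of_heads hδ hw]
    exact cross_ne_zero_of_isArm h (hK v) hv hu
  refine ⟨⟨?_, ?_⟩, ?_⟩
  · rw [← hvC]
    exact SimpleGraph.ConnectedComponent.sound hw.2.1.symm.reachable
  · intro hw0
    rw [hw0, cross_zero_right] at h1
    exact h1 rfl
  · refine (L.isArm_or_eq (h.heads_symm hw).1).resolve_right fun hKw => h1 ?_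
    have := hK w
    rw [← hKw, latticeVec_neg, cross_neg_left] at this
    linarith

/-- On each component, a displacement that fixes the intersection points is determined by its value
at a suitable vertex. -/
theorem exists_determining_vertex (h : Γ.IsTropicalCurve) (L : Γ.TripodLabelling c)
    (C : Γ.graph.ConnectedComponent) :
    ∃ v, ∀ δ ∈ Γ.slopeSpace, L.shift δ = 0 → δ v = 0 →
      ∀ w, Γ.graph.connectedComponentMk w = C → δ w = 0 := by
  -- The strand of all vertices of `C` moved by some kernel element. The moving set of each single
  -- element is a substrand, so one vertex serves for all of them.
  let B : Set (Fin Γ.n) := {v | ∃ δ ∈ Γ.slopeSpace, L.shift δ = 0 ∧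
    Γ.graph.connectedComponentMk v = C ∧ δ v ≠ 0}
  have hB : L.IsStrand B := by
    rintro v ⟨δ, hδ, h0, hv⟩ u hu w hw
    obtain ⟨h1, h2⟩ := isStrand_of_shift_eq_zero h hδ h0 C v hv u hu w hw
    exact ⟨⟨δ, hδ, h0, h1⟩, h2⟩
  by_cases hne : B.Nonempty
  · obtain ⟨v, hv, hmin⟩ := exists_mem_substrand h hB hne
    refine ⟨v, fun δ hδ h0 hδv w hw => ?_⟩
    by_contra hδw
    have hvC : Γ.graph.connectedComponentMk v = C := by
      obtain ⟨_, _, _, hvC, _⟩ := hv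
      exact hvC
    exact (hmin _ (fun z hz => ⟨δ, hδ, h0, hz⟩) (isStrand_of_shift_eq_zero h hδ h0 C)
      ⟨w, ⟨hw, hδw⟩, SimpleGraph.ConnectedComponent.exact (hw.trans hvC.symm)⟩).2 hδv
  · refine ⟨⟨0, h.nonempty⟩, fun δ hδ h0 _ w hw => ?_⟩
    by_contra hδw
    exact hne ⟨w, δ, hδ, h0, hw, hδw⟩

theorem finrank_ker_shift_le (h : Γ.IsTropicalCurve) (L : Γ.TripodLabelling c) :
    Module.finrank ℝ (LinearMap.ker (L.shift.domRestrict Γ.slopeSpace)) ≤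
      Nat.card Γ.graph.ConnectedComponent := by
  classical
  choose b hb using exists_determining_vertex h L
  -- One coordinate per component is enough: at the determining vertex a kernel element is a
  -- multiple of `K`, which the determinant with `I` detects.
  let f : (Fin Γ.n → Plane) →ₗ[ℝ] (Γ.graph.ConnectedComponent → ℝ) :=
    LinearMap.pi fun C => (crossLin (latticeVec (L.I (b C)))).comp (LinearMap.proj (b C))
  let N := LinearMap.ker (L.shift.domRestrict Γ.slopeSpace)
  have hinj : Function.Injective (f.comp (Γ.slopeSpace.subtype.comp N.subtype)) := by
    rw [injective_iff_map_eq_zero]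
    rintro ⟨⟨δ, hδ⟩, h0⟩ hf
    have h0' : L.shift δ = 0 := h0
    have hf' : ∀ C, cross (latticeVec (L.I (b C))) (δ (b C)) = 0 := congrFun hf
    have : δ = 0 := by
      funext w
      refine hb _ δ hδ h0' ?_ w rfl
      by_contra hne
      exact cross_ne_zero_of_isArm h ((L.shift_eq_zero_iff h).1 h0' _) hne (Or.inl rfl) (hf' _)
    subst this
    rfl
  have := LinearMap.finrank_le_finrank_of_injective hinj
  rwa [Module.finrank_fintype_fun_eq_card, ← Nat.card_eq_fintype_card] at this

theorem le_finrank_range_shift (h : Γ.IsTropicalCurve) (L : Γ.TripodLabelling c) :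
    2 * Γ.n ≤ Module.finrank ℝ (LinearMap.range (L.shift.domRestrict Γ.slopeSpace)) +
      Nat.card Γ.graph.ConnectedComponent + Nat.card Γ.graph.edgeSet := by
  have h1 := finrank_ker_shift_le h L
  have h2 := LinearMap.finrank_range_add_finrank_ker (L.shift.domRestrict Γ.slopeSpace)
  have h3 := le_finrank_slopeSpace (Γ := Γ)
  omega

end TripodLabelling

/-- A lattice vector parallel to `(1, √2)` would make `√2` rational. This supplies the generic
direction for every curve at once. -/
theorem cross_sqrt_two_ne_zero {u : ℤ × ℤ} (hu : IsCoprime u.1 u.2) :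
    cross (latticeVec u) (1, √2) ≠ 0 := by
  intro h0
  have h1 : (u.1 : ℝ) * √2 - u.2 * 1 = 0 := h0
  by_cases hz : u.1 = 0
  · have h2 : u.2 = 0 := by
      rw [hz] at h1
      have : (u.2 : ℝ) = 0 := by simpa using h1
      exact_mod_cast this
    rw [hz, h2] at hu
    exact not_isCoprime_zero_zero hu
  · refine irrational_sqrt_two ⟨(u.2 : ℚ) / u.1, ?_⟩
    have : (u.1 : ℝ) ≠ 0 := by exact_mod_cast hz
    push_cast
    rw [div_eq_iff this]
    linarith

end PlaneGraph

end

/-! ### The family of divisors -/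

/-- The `m`-dimensional set of divisors is a nonempty relatively open piece `U ∩ L` of an
`m`-dimensional affine subspace `L` of `(ℝ²)^d`, contained in the pullback of `R_Γ^st` to `Γ^d`;
its members are already cut out by smooth curves with the same subdivided dual polygon as `Γ`. -/
theorem mainTheorem4 (Γ : PlaneGraph) (hΓ : Γ.IsTropicalCurve) (hsmooth : Γ.IsSmooth) :
    ∃ (L : AffineSubspace ℝ (Fin Γ.n → Plane)) (U : Set (Fin Γ.n → Plane)),
      IsOpen U ∧ (U ∩ (L : Set (Fin Γ.n → Plane))).Nonempty ∧
      (Module.finrank ℝ L.direction : ℤ) = (Γ.n : ℤ) - Γ.genus ∧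
      U ∩ (L : Set (Fin Γ.n → Plane)) ⊆ Γ.pullback Γ.n Γ.stableLocus ∧
      ∀ x ∈ U ∩ (L : Set (Fin Γ.n → Plane)), ∃ Γ' : PlaneGraph,
        Γ'.IsTropicalCurve ∧ Γ'.IsSmooth ∧ Γ.SameSubdividedDualPolygon Γ' ∧
        Γ.IsStableIntersection Γ' (divisorOf x) := by
  obtain ⟨η, hη⟩ := hΓ.exists_isSmallScale
  obtain ⟨T⟩ := hsmooth.nonempty_tripodLabelling hΓ fun v u hu =>
    PlaneGraph.cross_sqrt_two_ne_zero (hΓ.primitive v u hu)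
  obtain ⟨s, hs⟩ := T.exists_const_mem_admissible hη.pos
  let F := T.shift.domRestrict Γ.slopeSpace
  let δ₀ : Γ.slopeSpace := ⟨_, PlaneGraph.const_mem_slopeSpace (s • (1, √2))⟩
  have hcard := hΓ.card_edges_add_card_components_le hsmooth
  have hrank : 2 * Γ.n ≤ Module.finrank ℝ (LinearMap.range F) +
      Nat.card Γ.graph.ConnectedComponent + Nat.card Γ.graph.edgeSet :=
    PlaneGraph.TripodLabelling.le_finrank_range_shift hΓ T
  -- Only a lower bound for the rank is known, so a subspace of dimension exactly `2d - e - k = d -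
  -- g` is chosen in the range.
  obtain ⟨M, hM, hMm⟩ := (LinearMap.range F).exists_le_finrank_eq
    (m := 2 * Γ.n - (Nat.card Γ.graph.edgeSet + Nat.card Γ.graph.ConnectedComponent)) (by omega)
  -- A linear map is open onto its finite-dimensional range, so the intersection points of
  -- admissible displacements fill a relatively open set.
  have hFopen : IsOpenMap F.rangeRestrict :=
    F.rangeRestrict.isOpenMap_of_finiteDimensional F.surjective_rangeRestrict
  obtain ⟨U, hU, hUeq⟩ := isOpen_induced_iff.1
    (hFopen _ ((T.isOpen_admissible η).preimage continuous_subtype_val))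
  have hmem : ∀ x : Fin Γ.n → Plane, x - Γ.pos ∈ U → x - Γ.pos ∈ LinearMap.range F →
      ∃ δ ∈ Γ.slopeSpace, δ ∈ T.admissible η ∧ x = fun v => Γ.pos v + T.shift δ v := by
    intro x hx hx'
    have h1 : (⟨x - Γ.pos, hx'⟩ : LinearMap.range F) ∈ Subtype.val ⁻¹' U := hx
    rw [hUeq] at h1
    obtain ⟨⟨δ, hδ⟩, hadm, heq⟩ := h1
    refine ⟨δ, hδ, hadm, ?_⟩
    have h2 : T.shift δ = x - Γ.pos := congrArg Subtype.val heq
    funext v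
    rw [h2, Pi.sub_apply, add_sub_cancel]
  have hcurve : ∀ x ∈ (fun x => x - Γ.pos) ⁻¹' U ∩
      (AffineSubspace.mk' (Γ.pos + F δ₀) M : Set (Fin Γ.n → Plane)),
      (∀ v, x v ∈ Γ.support) ∧ ∃ Γ' : PlaneGraph,
        Γ'.IsTropicalCurve ∧ Γ'.IsSmooth ∧ Γ.SameSubdividedDualPolygon Γ' ∧
        Γ.IsStableIntersection Γ' (divisorOf x) := by
    rintro x ⟨hxU, hxL⟩
    rw [SetLike.mem_coe, AffineSubspace.mem_mk', vsub_eq_sub] at hxL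
    have hx' : x - Γ.pos ∈ LinearMap.range F := by
      have := add_mem (hM hxL) (LinearMap.mem_range_self F δ₀)
      convert this using 1
      abel
    obtain ⟨δ, hδ, hadm, rfl⟩ := hmem x hxU hx'
    have hsmall := fun v => (hadm v).1
    exact ⟨fun v => Or.inr ⟨_, _, hΓ.isReversible.isOpenEdge_iff.2 ⟨v, T.J_mem v, rfl⟩,
        T.shift_mem_openEdge hΓ hη hadm v⟩,
      Γ.deform δ, PlaneGraph.deform_isTropicalCurve hΓ hη hδ hsmall, hsmooth,
      PlaneGraph.deform_sameSubdividedDualPolygon hΓ hη hδ hsmall,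
      (T.isProperIntersection_deform hΓ hη hδ hadm).isStableIntersection⟩
  refine ⟨AffineSubspace.mk' (Γ.pos + F δ₀) M, (fun x => x - Γ.pos) ⁻¹' U,
    hU.preimage (continuous_id.sub continuous_const), ⟨Γ.pos + F δ₀, ?_,
      AffineSubspace.self_mem_mk' _ _⟩, ?_, fun x hx => ?_, fun x hx => (hcurve x hx).2⟩
  · have h1 : F.rangeRestrict δ₀ ∈ Subtype.val ⁻¹' U := by
      rw [hUeq]
      exact ⟨δ₀, hs, rfl⟩
    simpa using h1
  · rw [AffineSubspace.direction_mk', hMm, PlaneGraph.genus]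
    push_cast [Nat.cast_sub hcard]
    ring
  · obtain ⟨hsupp, Γ', h1, -, h2, h3⟩ := hcurve x hx
    exact ⟨hsupp, Γ', h1, h2.sameDualPolygon, h3⟩
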